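/- Let $p\ge 5$ be a prime and let $\mathcal K$ be a field of characteristic $p$ that is complete with respect to a non-Archimedean absolute value $|\cdot|$. Call a power series over $\mathcal K$ locally analytic at $z=0$ if it converges on a disc of positive radius around $0$. A locally analytic power series $f(z)=\lambda z+\sum_{i\ge 1}a_i z^{i+1}$ over $\mathcal K$ is called linearizable if there is a locally analytic power series $h(z)=b_0z+b_1z^2+\cdots\in\mathcal K[[z]]$ with $b_0\ne 0$ such that $h\circ f\circ h^{-1}(z)=\lambda z$, where $h^{-1}$ is the inverse of $h$ under composition. **Theorem 1.5.** Let $\lambda\in\mathcal K$ be not a root of unity and satisfy $|1-\lambda|<1$, and let $a_1,a_{p-1}\in\mathcal K$. Then the polynomial $\lambda z+a_1z^2+a_{p-1}z^p\in\mathcal K[z]$ is linearizable if and only if $a_1=0$. -/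

import Mathlib

namespace NonArchLinearization

variable {K : Type*} [NormedField K]

/-- A power series over a non-Archimedean field is locally analytic at `z = 0` if it converges on
a disc of positive radius, i.e. `‖aₙ‖ rⁿ → 0` for some `r > 0`. -/
def IsLocallyAnalytic (f : PowerSeries K) : Prop :=
  ∃ r : ℝ, 0 < r ∧ PowerSeries.IsRestricted r f

/-- A power series `f` without constant term, with linear coefficient `λ`, is (locally)
linearizable at `z = 0` if there is a locally analytic power series `h(z) = b₀ z + b₁ z² + ⋯`
with `b₀ ≠ 0` such that `h ∘ f ∘ h⁻¹ = λ z`. Here `g.subst a` is the composition `g ∘ a`, and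
`h.substInvOfIsUnit hb` is the inverse of `h` for composition. -/
def IsLinearizable (f : PowerSeries K) : Prop :=
  ∃ (h : PowerSeries K) (hb : IsUnit (PowerSeries.coeff 1 h)),
    IsLocallyAnalytic h ∧ PowerSeries.constantCoeff h = 0 ∧
      h.subst (f.subst (h.substInvOfIsUnit hb)) =
        PowerSeries.C (PowerSeries.coeff 1 f) * PowerSeries.X

end NonArchLinearization

/-!
Linearizability of `f = λz + ⋯` amounts to a convergent solution `ψ = h⁻¹` of `f ∘ ψ = ψ(λ ·)`.
Let `A` be the operator of composition with `f`. On the coefficients of `F ∘ ψ` the product of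
the `A - λⁱ`, `i < N`, acts as multiplication by the products of the `λⁿ - λⁱ`. These are
divisible, by integrality of the Gaussian binomial coefficients, by the product of the `λⁱ - 1`,
`1 ≤ i ≤ N`, which in characteristic `p` decays superexponentially in `N`.

On a disc where `(f - z) / (λ - 1)` is integral, this forces all the `λ`-binomial operators in
`A` to be integral: by the `λ`-Leibniz rule, the first one which is not would be close to a
vector field with large iterates. Hence the multipliers of the fixed points in this disc are
limits of powers of `λ`. For `f = λz + bz² + azᵖ` with `b ≠ 0`, over an algebraically closed
field, this is contradicted by the multipliers themselves unless `β = a(λ - 1)ᵖ⁻² / bᵖ⁻¹`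
satisfies `‖λ - 1‖ ≤ ‖β‖ < 1`. In that range one can scale `f` to `λz + μ(z² + zᵖ)` with
`‖λ - 1‖ < ‖μ‖ < 1`, and the decay is contradicted by the powers of `A` because the vector field
`(z² + zᵖ) ∂` is not nilpotent: its square multiplies `(z² + zᵖ) ^ ((p - 1) / 2)` by `-zᵖ`.

Conversely, a series supported on exponents `pᵏ` is additive, so for `f = λz + azᵖ` the equation
`h ∘ f = λh` has such a solution, given by a recursion whose denominators `λⁿ - λ` all have the
norm of `λ - 1`.
-/

namespace NonArchLinearization

open Polynomial Finset

section QFactorial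

variable {R : Type*} [CommRing R]

/-- The product `(λⁿ - 1)(λⁿ⁺¹ - 1) ⋯ (λⁿ⁺ᵏ⁻¹ - 1)`; for `n = 1` this is the `λ`-factorial of `k`
up to the factor `(λ - 1)ᵏ`. -/
def qRising (lam : R) (n k : ℕ) : R := ∏ i ∈ range k, (lam ^ (n + i) - 1)

/-- The `λ`-falling factorial `(X - λᵗ)(X - λᵗ⁺¹) ⋯ (X - λᵗ⁺ᵏ⁻¹)`. -/
noncomputable def qFalling (lam : R) (t k : ℕ) : R[X] := ∏ i ∈ range k, (X - C (lam ^ (t + i)))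

lemma qRising_zero (lam : R) (n : ℕ) : qRising lam n 0 = 1 := prod_range_zero _

lemma qRising_succ (lam : R) (n k : ℕ) :
    qRising lam n (k + 1) = qRising lam n k * (lam ^ (n + k) - 1) :=
  prod_range_succ _ _

lemma qRising_add (lam : R) (n a b : ℕ) :
    qRising lam n (a + b) = qRising lam n a * qRising lam (n + a) b := by
  simp only [qRising, prod_range_add, add_assoc]

lemma qRising_succ' (lam : R) (n k : ℕ) :
    qRising lam n (k + 1) = (lam ^ n - 1) * qRising lam (n + 1) k := by
  rw [add_comm k, qRising_add, qRising_succ, qRising_zero, one_mul, add_zero]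

lemma qRising_one_ne_zero [IsDomain R] {lam : R} (hroot : ∀ n : ℕ, 0 < n → lam ^ n ≠ 1) (k : ℕ) :
    qRising lam 1 k ≠ 0 :=
  prod_ne_zero_iff.2 fun i _ => sub_ne_zero.2 (hroot _ (by omega))

lemma qFalling_zero (lam : R) (t : ℕ) : qFalling lam t 0 = 1 := prod_range_zero _

lemma qFalling_succ (lam : R) (t k : ℕ) :
    qFalling lam t (k + 1) = qFalling lam t k * (X - C (lam ^ (t + k))) := prod_range_succ _ _

lemma qFalling_add (lam : R) (t a b : ℕ) :
    qFalling lam t (a + b) = qFalling lam t a * qFalling lam (t + a) b := by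
  simp only [qFalling, prod_range_add, add_assoc]

lemma eval_pow_qFalling_of_lt (lam : R) {n k : ℕ} (h : n < k) :
    (qFalling lam 0 k).eval (lam ^ n) = 0 := by
  rw [qFalling, eval_prod]
  exact prod_eq_zero (mem_range.2 h) (by simp)

lemma eval_pow_add_qFalling (lam : R) (m k : ℕ) :
    (qFalling lam 0 k).eval (lam ^ (k + m))
      = (∏ i ∈ range k, lam ^ (k - 1 - i)) * qRising lam (m + 1) k := by
  rw [qFalling, qRising, eval_prod, ← prod_range_reflect, ← prod_mul_distrib]
  refine prod_congr rfl fun i hi => ?_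
  have hi := mem_range.1 hi
  rw [eval_sub, eval_X, eval_C, zero_add, mul_sub, ← pow_add, mul_one]
  congr 2
  omega

/-- The `λ`-Pascal rule `(λⁿ - 1) = (λʲ - 1) + λʲ (λⁱ - 1)` for `i + j = n`, summed. -/
lemma sum_antidiagonal_succ_qPascal {M : Type*} [AddCommGroup M] [Module R M] (lam : R) (m : ℕ)
    (T : ℕ → ℕ → M) :
    (lam ^ (m + 1) - 1) • ∑ x ∈ antidiagonal (m + 1), T x.1 x.2
      = ∑ x ∈ antidiagonal m, ((lam ^ (x.2 + 1) - 1) • T x.1 (x.2 + 1)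
          + (lam ^ x.2 * (lam ^ (x.1 + 1) - 1)) • T (x.1 + 1) x.2) := by
  have hpascal : ∀ x ∈ antidiagonal (m + 1), (lam ^ (m + 1) - 1) • T x.1 x.2
      = (lam ^ x.2 - 1) • T x.1 x.2 + (lam ^ x.2 * (lam ^ x.1 - 1)) • T x.1 x.2 := by
    intro x hx
    rw [← add_smul, ← mem_antidiagonal.1 hx]
    congr 1
    ring
  rw [smul_sum, sum_congr rfl hpascal, sum_add_distrib,
    Nat.sum_antidiagonal_succ' (f := fun x => (lam ^ x.2 - 1) • T x.1 x.2),
    Nat.sum_antidiagonal_succ (f := fun x => (lam ^ x.2 * (lam ^ x.1 - 1)) • T x.1 x.2)]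
  simp only [pow_zero, sub_self, zero_smul, mul_zero, zero_add, sum_add_distrib]

end QFactorial

section QBinomial

variable {L : Type*} [Field L]

/-- The polynomial whose value at `λⁿ` is the Gaussian binomial coefficient of `n` over `m`. -/
noncomputable def qChoose (lam : L) (m : ℕ) : L[X] := C (qRising lam 1 m)⁻¹ * qFalling lam 0 m

lemma qChoose_zero (lam : L) : qChoose lam 0 = 1 := by
  rw [qChoose, qRising_zero, qFalling_zero, inv_one, C_1, one_mul]

lemma qChoose_succ (lam : L) (m : ℕ) :
    qChoose lam (m + 1) = C (lam ^ (m + 1) - 1)⁻¹ * ((X - C (lam ^ m)) * qChoose lam m) := by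
  rw [qChoose, qChoose, qRising_succ, qFalling_succ, zero_add, add_comm 1 m, mul_inv, C_mul]
  ring

variable {lam : L}

lemma X_mul_qChoose (hroot : ∀ n : ℕ, 0 < n → lam ^ n ≠ 1) (m : ℕ) :
    X * qChoose lam m = (lam ^ (m + 1) - 1) • qChoose lam (m + 1) + lam ^ m • qChoose lam m := by
  have h : lam ^ (m + 1) - 1 ≠ 0 := sub_ne_zero.2 (hroot _ m.succ_pos)
  rw [qChoose_succ, ← smul_eq_C_mul, smul_inv_smul₀ h, smul_eq_C_mul]
  ring

/-- The coefficient of `qChoose lam (m - j)` in the expansion of `qFalling lam t m`, up to the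
factor `qRising lam 1 m`. -/
def qVandermondeCoeff (lam : L) (t j : ℕ) : L := (-1) ^ j * qRising lam t j / qRising lam 1 j

lemma qVandermondeCoeff_zero (t : ℕ) : qVandermondeCoeff lam t 0 = 1 := by
  simp [qVandermondeCoeff, qRising_zero]

lemma sub_one_mul_qVandermondeCoeff_succ (hroot : ∀ n : ℕ, 0 < n → lam ^ n ≠ 1) (t j : ℕ) :
    (lam ^ (j + 1) - 1) * qVandermondeCoeff lam t (j + 1)
      = (1 - lam ^ (t + j)) * qVandermondeCoeff lam t j := by
  have h₁ := qRising_one_ne_zero hroot j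
  have h₂ : lam ^ (j + 1) - 1 ≠ 0 := sub_ne_zero.2 (hroot _ j.succ_pos)
  rw [qVandermondeCoeff, qVandermondeCoeff, qRising_succ, qRising_succ, add_comm 1 j]
  field_simp
  ring

lemma qFalling_eq_sum_qChoose (hroot : ∀ n : ℕ, 0 < n → lam ^ n ≠ 1) (t m : ℕ) :
    qFalling lam t m = qRising lam 1 m •
      ∑ x ∈ antidiagonal m, qVandermondeCoeff lam t x.1 • qChoose lam x.2 := by
  induction m with
  | zero => simp [qFalling_zero, qRising_zero, qVandermondeCoeff_zero, qChoose_zero]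
  | succ m ih =>
    rw [qFalling_succ, ih, qRising_succ, mul_smul, add_comm 1 m,
      sum_antidiagonal_succ_qPascal lam m (fun i j => qVandermondeCoeff lam t i • qChoose lam j),
      smul_mul_assoc, sum_mul]
    congr 1
    refine sum_congr rfl fun x hx => ?_
    rw [← mem_antidiagonal.1 hx, smul_mul_assoc, mul_sub, mul_comm _ X, X_mul_qChoose hroot,
      smul_smul (lam ^ x.2 * _), mul_assoc, sub_one_mul_qVandermondeCoeff_succ hroot]
    simp only [smul_eq_C_mul, C_sub, C_mul, C_1, pow_add, C_pow]
    ring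

end QBinomial

section CompositionOperators

/-- The algebra homomorphism `P ↦ P(A)`, where `A` is the operator `F ↦ F ∘ f`. -/
noncomputable def compOp {R : Type*} [CommRing R] (f : R[X]) : R[X] →ₐ[R] Module.End R R[X] :=
  aeval (aeval f).toLinearMap

section CommRing

variable {R : Type*} [CommRing R] {f : R[X]}

lemma compOp_X (f F : R[X]) : compOp f X F = F.comp f := by
  simp [compOp, comp_eq_aeval]

lemma compOp_mul (P Q F : R[X]) : compOp f (P * Q) F = compOp f P (compOp f Q F) := by
  rw [map_mul, Module.End.mul_apply]

lemma compOp_one (F : R[X]) : compOp f 1 F = F := by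
  rw [map_one, Module.End.one_apply]

lemma compOp_C (a : R) (F : R[X]) : compOp f (C a) F = a • F := by
  rw [← algebraMap_eq, AlgHom.commutes, Module.algebraMap_end_apply]

lemma compOp_X_sub_C (a : R) (F : R[X]) : compOp f (X - C a) F = F.comp f - a • F := by
  rw [map_sub, LinearMap.sub_apply, compOp_X, compOp_C]

lemma eval_compOp {x : R} (hx : f.eval x = x) (P F : R[X]) :
    (compOp f P F).eval x = P.eval 1 * F.eval x := by
  induction P using Polynomial.induction_on generalizing F with
  | C a => rw [compOp_C, eval_smul, eval_C, smul_eq_mul]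
  | add P Q hP hQ => rw [map_add, LinearMap.add_apply, eval_add, hP, hQ, eval_add, add_mul]
  | monomial k a ih =>
    rw [pow_succ, ← mul_assoc, compOp_mul, compOp_X, ih, eval_comp, hx, eval_mul_X, mul_one]

lemma eval_derivative_compOp {x : R} (hx : f.eval x = x) (P F : R[X]) :
    (derivative (compOp f P F)).eval x
      = P.eval ((derivative f).eval x) * (derivative F).eval x := by
  induction P using Polynomial.induction_on generalizing F with
  | C a => rw [compOp_C, derivative_smul, eval_smul, eval_C, smul_eq_mul]
  | add P Q hP hQ =>
    rw [map_add, LinearMap.add_apply, derivative_add, eval_add, hP, hQ, eval_add, add_mul]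
  | monomial k a ih =>
    have hF : (derivative (F.comp f)).eval x = (derivative f).eval x * (derivative F).eval x := by
      rw [derivative_comp, eval_mul, eval_comp, hx]
    rw [pow_succ, ← mul_assoc, compOp_mul, compOp_X, ih, hF, eval_mul_X, mul_assoc]

/-- If `f ∘ ψ = ψ(λ ·)`, then `F ∘ f ∘ ψ = (F ∘ ψ)(λ ·)`, so that `A` acts on the coefficients of
`F ∘ ψ` as the diagonal matrix of the `λⁿ`. -/
lemma coeff_aeval_compOp {lam : R} {ψ : PowerSeries R}
    (hψ : aeval ψ f = PowerSeries.rescale lam ψ) (P F : R[X]) (n : ℕ) :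
    PowerSeries.coeff n (aeval ψ (compOp f P F))
      = P.eval (lam ^ n) * PowerSeries.coeff n (aeval ψ F) := by
  induction P using Polynomial.induction_on generalizing F with
  | C a => rw [compOp_C, map_smul, map_smul, eval_C, smul_eq_mul]
  | add P Q hP hQ => rw [map_add, LinearMap.add_apply, map_add, map_add, hP, hQ, eval_add, add_mul]
  | monomial k a ih =>
    have hcomp : aeval ψ (F.comp f) = PowerSeries.rescale lam (aeval ψ F) := by
      rw [aeval_comp, hψ, ← PowerSeries.coe_rescaleAlgHom]
      exact aeval_algHom_apply (PowerSeries.rescaleAlgHom lam) ψ F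
    rw [pow_succ, ← mul_assoc, compOp_mul, compOp_X, ih, hcomp, PowerSeries.coeff_rescale,
      eval_mul_X, mul_assoc]

end CommRing

section Field

variable {L : Type*} [Field L] {f : L[X]} {lam : L}

lemma compOp_qChoose_one {m : ℕ} (hm : 0 < m) : compOp f (qChoose lam m) 1 = 0 := by
  have hX : compOp f (X - C (lam ^ 0)) 1 = 0 := by
    rw [compOp_X_sub_C, one_comp, pow_zero, one_smul, sub_self]
  rw [qChoose, ← Nat.sub_add_cancel hm, add_comm _ 1, qFalling_add, qFalling_succ, qFalling_zero,
    one_mul, add_zero, mul_comm (X - _), ← mul_assoc, compOp_mul, hX, map_zero]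

lemma compOp_X_pow_succ_mul_qChoose (hroot : ∀ n : ℕ, 0 < n → lam ^ n ≠ 1) (k m : ℕ) (F : L[X]) :
    compOp f (X ^ (k + 1) * qChoose lam m) F
      = (lam ^ (m + 1) - 1) • compOp f (X ^ k * qChoose lam (m + 1)) F
        + lam ^ m • compOp f (X ^ k * qChoose lam m) F := by
  rw [pow_succ, mul_assoc, X_mul_qChoose hroot, mul_add, mul_smul_comm, mul_smul_comm, map_add,
    map_smul, map_smul, LinearMap.add_apply, LinearMap.smul_apply, LinearMap.smul_apply]

/-- The `λ`-Leibniz rule. -/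
lemma compOp_qChoose_mul (hroot : ∀ n : ℕ, 0 < n → lam ^ n ≠ 1) (m : ℕ) (F G : L[X]) :
    compOp f (qChoose lam m) (F * G) = ∑ x ∈ antidiagonal m,
      compOp f (X ^ x.2 * qChoose lam x.1) F * compOp f (qChoose lam x.2) G := by
  induction m with
  | zero => simp [qChoose_zero]
  | succ m ih =>
    let T i j := compOp f (X ^ j * qChoose lam i) F * compOp f (qChoose lam j) G
    have hX : ∀ i j, (T i j).comp f = (lam ^ (j + 1) - 1) • T i (j + 1)
        + (lam ^ j * (lam ^ (i + 1) - 1)) • T (i + 1) j + lam ^ (i + j) • T i j := by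
      intro i j
      have hG := compOp_X_pow_succ_mul_qChoose (f := f) hroot 0 j G
      rw [zero_add, pow_one, pow_zero, one_mul, one_mul] at hG
      have hF := compOp_X_pow_succ_mul_qChoose (f := f) hroot j i F
      calc (T i j).comp f
          = compOp f (X ^ (j + 1) * qChoose lam i) F * compOp f (X * qChoose lam j) G := by
            rw [mul_comp, ← compOp_X, ← compOp_X, ← compOp_mul, ← compOp_mul, ← mul_assoc,
              ← pow_succ']
        _ = (lam ^ (j + 1) - 1) • T i (j + 1)
              + lam ^ j •
                (compOp f (X ^ (j + 1) * qChoose lam i) F * compOp f (qChoose lam j) G) := by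
            rw [hG, mul_add, mul_smul_comm, mul_smul_comm]
        _ = _ := by
            rw [hF, add_mul, smul_mul_assoc, smul_mul_assoc, smul_add, smul_smul, smul_smul,
              ← pow_add, add_comm j i, ← add_assoc]
    have hm : lam ^ (m + 1) - 1 ≠ 0 := sub_ne_zero.2 (hroot _ m.succ_pos)
    rw [qChoose_succ, compOp_mul, compOp_C, inv_smul_eq_iff₀ hm,
      sum_antidiagonal_succ_qPascal lam m T, compOp_mul, ih, compOp_X_sub_C, ← compOp_X, map_sum,
      smul_sum, ← sum_sub_distrib]
    refine sum_congr rfl fun x hx => ?_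
    rw [compOp_X, hX, mem_antidiagonal.1 hx, add_sub_cancel_right]

end Field

end CompositionOperators

section Ultrametric

section AddGroup

variable {E : Type*} [SeminormedAddCommGroup E] [IsUltrametricDist E] {x y : E} {B : ℝ}

lemma norm_add_le_of_norm_le (hx : ‖x‖ ≤ B) (hy : ‖y‖ ≤ B) : ‖x + y‖ ≤ B :=
  (IsUltrametricDist.norm_add_le_max x y).trans (max_le hx hy)

lemma norm_sub_le_of_norm_le (hx : ‖x‖ ≤ B) (hy : ‖y‖ ≤ B) : ‖x - y‖ ≤ B :=
  sub_eq_add_neg x y ▸ norm_add_le_of_norm_le hx (by rwa [norm_neg])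

lemma norm_add_lt_of_norm_lt (hx : ‖x‖ < B) (hy : ‖y‖ < B) : ‖x + y‖ < B :=
  (IsUltrametricDist.norm_add_le_max x y).trans_lt (max_lt hx hy)

lemma norm_sub_lt_of_norm_lt (hx : ‖x‖ < B) (hy : ‖y‖ < B) : ‖x - y‖ < B :=
  sub_eq_add_neg x y ▸ norm_add_lt_of_norm_lt hx (by rwa [norm_neg])

lemma norm_sum_lt_of_forall_lt {ι : Type*} {s : Finset ι} {f : ι → E} (hB : 0 < B)
    (h : ∀ i ∈ s, ‖f i‖ < B) : ‖∑ i ∈ s, f i‖ < B :=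
  sum_induction f (‖·‖ < B) (fun _ _ => norm_add_lt_of_norm_lt) (by rwa [norm_zero]) h

lemma norm_eq_of_norm_sub_lt (h : ‖x - y‖ < ‖y‖) : ‖x‖ = ‖y‖ := by
  have hmax := IsUltrametricDist.norm_add_eq_max_of_norm_ne_norm h.ne
  rwa [sub_add_cancel, max_eq_right h.le] at hmax

end AddGroup

variable {L : Type*} [NormedField L] [IsUltrametricDist L] {lam x : L}

lemma norm_eq_one_of_norm_sub_one_lt (h : ‖x - 1‖ < 1) : ‖x‖ = 1 := by
  rw [norm_eq_of_norm_sub_lt (y := 1) (by rwa [norm_one]), norm_one]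

lemma norm_pow_sub_pow_le {y : L} (hx : ‖x‖ ≤ 1) (hy : ‖y‖ ≤ 1) (n : ℕ) :
    ‖x ^ n - y ^ n‖ ≤ ‖x - y‖ := by
  rw [← geom_sum₂_mul, norm_mul]
  refine mul_le_of_le_one_left (norm_nonneg _)
    (IsUltrametricDist.norm_sum_le_of_forall_le_of_nonneg zero_le_one fun i _ => ?_)
  rw [norm_mul, norm_pow, norm_pow]
  exact mul_le_one₀ (pow_le_one₀ (norm_nonneg x) hx) (pow_nonneg (norm_nonneg y) _)
    (pow_le_one₀ (norm_nonneg y) hy)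

lemma norm_pow_sub_one_le (h : ‖x‖ ≤ 1) (n : ℕ) : ‖x ^ n - 1‖ ≤ ‖x - 1‖ := by
  simpa only [one_pow] using norm_pow_sub_pow_le h norm_one.le n

/-- Equivalently, the Gaussian binomial coefficients at `λ` are integral. -/
lemma norm_qRising_le (h : ‖lam‖ ≤ 1) (n k : ℕ) : ‖qRising lam n k‖ ≤ ‖qRising lam 1 k‖ := by
  induction k generalizing n with
  | zero => simp only [qRising_zero, le_refl]
  | succ k ih =>
    induction n with
    | zero => rw [qRising_succ', pow_zero, sub_self, zero_mul, norm_zero]; exact norm_nonneg _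
    | succ n ihn =>
      have hrec : qRising lam (n + 1) (k + 1) = qRising lam n (k + 1)
          + lam ^ n * qRising lam (n + 1) k * (lam ^ (1 + k) - 1) := by
        rw [qRising_succ, qRising_succ' lam n]; ring
      rw [hrec]
      refine norm_add_le_of_norm_le ihn ?_
      rw [qRising_succ lam 1 k, norm_mul, norm_mul, norm_mul, norm_pow]
      refine mul_le_mul_of_nonneg_right ?_ (norm_nonneg _)
      exact (mul_le_of_le_one_left (norm_nonneg _) (pow_le_one₀ (norm_nonneg _) h)).trans (ih _)

lemma norm_qVandermondeCoeff_le_one (h : ‖lam‖ ≤ 1) (t j : ℕ) :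
    ‖qVandermondeCoeff lam t j‖ ≤ 1 := by
  rw [qVandermondeCoeff, norm_div, norm_mul, norm_pow, norm_neg, norm_one, one_pow, one_mul]
  exact div_le_one_of_le₀ (norm_qRising_le h _ _) (norm_nonneg _)

lemma norm_eval_pow_qFalling_le (h : ‖lam‖ ≤ 1) (k n : ℕ) :
    ‖(qFalling lam 0 k).eval (lam ^ n)‖ ≤ ‖qRising lam 1 k‖ := by
  rcases lt_or_ge n k with hn | hn
  · rw [eval_pow_qFalling_of_lt lam hn, norm_zero]
    exact norm_nonneg _
  · obtain ⟨m, rfl⟩ := Nat.exists_eq_add_of_le hn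
    rw [eval_pow_add_qFalling, norm_mul, norm_prod]
    refine (mul_le_of_le_one_left (norm_nonneg _) (prod_le_one (fun _ _ => norm_nonneg _) ?_)).trans
      (norm_qRising_le h (m + 1) k)
    exact fun i _ => by rw [norm_pow]; exact pow_le_one₀ (norm_nonneg _) h

end Ultrametric

section CharP

variable {L : Type*} [NormedField L] {p : ℕ} [hp : Fact p.Prime] [CharP L p]

lemma norm_natCast_eq_one {n : ℕ} (hn : ¬ p ∣ n) : ‖(n : L)‖ = 1 := by
  have hn' : (n : ZMod p) ≠ 0 := fun h => hn ((ZMod.natCast_eq_zero_iff _ _).1 h)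
  have hpow : (n : L) ^ (p - 1) = 1 := by
    simpa using congrArg (ZMod.castHom dvd_rfl L) (ZMod.pow_card_sub_one_eq_one hn')
  rw [← pow_eq_one_iff_of_nonneg (norm_nonneg _) (Nat.sub_ne_zero_of_lt hp.out.one_lt), ← norm_pow,
    hpow, norm_one]

lemma pow_prime_pow_sub_one (x : L) (k : ℕ) : x ^ p ^ k - 1 = (x - 1) ^ p ^ k := by
  have : ExpChar L p := ExpChar.prime hp.out
  rw [sub_pow_expChar_pow, one_pow]

lemma pow_prime_sub_one (x : L) : x ^ p - 1 = (x - 1) ^ p := by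
  simpa only [pow_one] using pow_prime_pow_sub_one (p := p) x 1

variable [IsUltrametricDist L] {x : L}

lemma norm_pow_sub_one_of_not_dvd (hx : ‖x - 1‖ < 1) {n : ℕ} (hn : ¬ p ∣ n) :
    ‖x ^ n - 1‖ = ‖x - 1‖ := by
  have hsum : ‖∑ i ∈ range n, x ^ i‖ = ‖(n : L)‖ := by
    apply norm_eq_of_norm_sub_lt
    have : ∑ i ∈ range n, x ^ i - (n : L) = ∑ i ∈ range n, (x ^ i - 1) := by simp
    rw [norm_natCast_eq_one hn, this]
    have hx' := (norm_eq_one_of_norm_sub_one_lt hx).le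
    exact norm_sum_lt_of_forall_lt one_pos fun i _ => (norm_pow_sub_one_le hx' i).trans_lt hx
  rw [← mul_geom_sum, norm_mul, hsum, norm_natCast_eq_one hn, mul_one]

lemma exists_norm_pow_sub_one (hx : ‖x - 1‖ < 1) {n : ℕ} (hn : n ≠ 0) :
    ∃ k, ‖x ^ n - 1‖ = ‖x - 1‖ ^ p ^ k := by
  obtain ⟨k, m, hm, rfl⟩ := Nat.exists_eq_pow_mul_and_not_dvd hn p hp.out.ne_one
  exact ⟨k, by rw [pow_mul', pow_prime_pow_sub_one, norm_pow, norm_pow_sub_one_of_not_dvd hx hm]⟩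

lemma norm_pow_sub_one_le_pow_prime (hx : ‖x - 1‖ < 1) {a b : ℕ} (ha : a ≠ 0)
    (h : ‖x ^ b - 1‖ < ‖x ^ a - 1‖) : ‖x ^ b - 1‖ ≤ ‖x ^ a - 1‖ ^ p := by
  rcases eq_or_ne b 0 with rfl | hb
  · simp
  obtain ⟨k, hk⟩ := exists_norm_pow_sub_one (p := p) hx ha
  obtain ⟨l, hl⟩ := exists_norm_pow_sub_one (p := p) hx hb
  rw [hk, hl] at h ⊢
  have hkl : k < l := by
    by_contra! hlk
    exact h.not_ge (pow_le_pow_of_le_one (norm_nonneg _) hx.le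
      (Nat.pow_le_pow_right hp.out.pos hlk))
  rw [← pow_mul, ← pow_succ]
  exact pow_le_pow_of_le_one (norm_nonneg _) hx.le (Nat.pow_le_pow_right hp.out.pos hkl)

lemma norm_qRising_block {lam : L} (h : ‖lam - 1‖ < 1) (m : ℕ) :
    ‖qRising lam (1 + p * m) p‖ = ‖lam - 1‖ ^ (p - 1) * ‖lam ^ (m + 1) - 1‖ ^ p := by
  obtain ⟨r, hr⟩ : ∃ r, p = r + 1 := Nat.exists_eq_succ_of_ne_zero hp.out.ne_zero
  have hunit : ∀ i ∈ range r, ‖lam ^ (1 + p * m + i) - 1‖ = ‖lam - 1‖ := fun i hi => by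
    have hi := mem_range.1 hi
    refine norm_pow_sub_one_of_not_dvd h fun hd => ?_
    rw [add_right_comm, ← (Nat.dvd_add_iff_left (dvd_mul_right p m))] at hd
    exact absurd (Nat.le_of_dvd (by omega) hd) (by omega)
  have hlast : lam ^ (1 + p * m + r) - 1 = (lam ^ (m + 1) - 1) ^ p := by
    have hpow := pow_prime_sub_one (p := p) (lam ^ (m + 1))
    rw [← pow_mul] at hpow
    rw [← hpow]
    congr 2
    rw [add_mul, mul_comm m p]
    omega
  have hsplit : qRising lam (1 + p * m) p
      = qRising lam (1 + p * m) r * (lam ^ (1 + p * m + r) - 1) := by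
    rw [← qRising_succ, ← hr]
  rw [hsplit, hlast, norm_mul, norm_pow, qRising, norm_prod, prod_congr rfl hunit, prod_const,
    card_range, Nat.sub_eq_of_eq_add hr]

lemma norm_qRising_prime_mul {lam : L} (h : ‖lam - 1‖ < 1) (m : ℕ) :
    ‖qRising lam 1 (p * m)‖ = ‖qRising lam 1 m‖ ^ p * ‖lam - 1‖ ^ ((p - 1) * m) := by
  induction m with
  | zero => simp [qRising_zero]
  | succ m ih =>
    rw [mul_add, mul_one, qRising_add, norm_mul, ih, norm_qRising_block h, qRising_succ, norm_mul,
      add_comm 1 m]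
    ring

lemma norm_qRising_prime_pow_mul_le {lam : L} (h : ‖lam - 1‖ < 1) {m : ℕ} (hm : 0 < m) (k : ℕ) :
    ‖qRising lam 1 (p ^ k * m)‖ ≤ ‖qRising lam 1 m‖ ^ p ^ k * ‖lam - 1‖ ^ (k * p ^ (k - 1)) := by
  have hp1 : 1 ≤ p - 1 := Nat.sub_pos_of_lt hp.out.one_lt
  induction k with
  | zero => simp
  | succ k ih =>
    have hk : p * (k * p ^ (k - 1)) = k * p ^ k := by
      cases k with
      | zero => simp
      | succ k => rw [Nat.add_sub_cancel, pow_succ]; ring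
    have hexp : p ^ k ≤ (p - 1) * (p ^ k * m) := by
      calc p ^ k = 1 * (p ^ k * 1) := by ring
        _ ≤ (p - 1) * (p ^ k * m) := by gcongr; exact hm
    rw [pow_succ' p k, mul_assoc, norm_qRising_prime_mul h]
    calc _ ≤ (‖qRising lam 1 m‖ ^ p ^ k * ‖lam - 1‖ ^ (k * p ^ (k - 1))) ^ p
            * ‖lam - 1‖ ^ p ^ k := by
          refine mul_le_mul (pow_le_pow_left₀ (norm_nonneg _) ih _) ?_ (by positivity)
            (by positivity)
          exact pow_le_pow_of_le_one (norm_nonneg _) h.le hexp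
      _ = _ := by
          rw [mul_pow, ← pow_mul, ← pow_mul, mul_comm _ p, mul_comm _ p, hk, mul_assoc, ← pow_add,
            Nat.add_sub_cancel, Nat.succ_mul]

end CharP

lemma exists_mul_pow_lt_one {δ B D : ℝ} (hδ0 : 0 ≤ δ) (hδ : δ < 1) (hB : 0 ≤ B) (hD : 0 ≤ D)
    {p : ℕ} (hp : 1 < p) : ∃ k : ℕ, B * D ^ p ^ k * δ ^ (k * p ^ (k - 1)) < 1 := by
  have hδ' : Filter.Tendsto (fun k : ℕ => D ^ p * δ ^ (k + 1)) Filter.atTop (nhds 0) := by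
    simpa using ((tendsto_pow_atTop_nhds_zero_of_lt_one hδ0 hδ).comp
      (Filter.tendsto_add_atTop_nat 1)).const_mul (D ^ p)
  have hhalf : Filter.Tendsto (fun k : ℕ => B * (1 / 2 : ℝ) ^ p ^ k) Filter.atTop (nhds 0) := by
    simpa using ((tendsto_pow_atTop_nhds_zero_of_lt_one one_half_pos.le one_half_lt_one).comp
      (tendsto_pow_atTop_atTop_of_one_lt hp)).const_mul B
  obtain ⟨k, hk1, hk2⟩ := ((hδ'.eventually_lt_const one_half_pos).and
    (hhalf.eventually_lt_const one_pos)).exists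
  refine ⟨k + 1, lt_of_le_of_lt ?_ hk2⟩
  calc B * D ^ p ^ (k + 1) * δ ^ ((k + 1) * p ^ k) = B * (D ^ p * δ ^ (k + 1)) ^ p ^ k := by
        rw [mul_pow, ← pow_mul, ← pow_mul, pow_succ', mul_assoc]
    _ ≤ _ := mul_le_mul_of_nonneg_left (pow_le_pow_left₀ (by positivity) hk1.le _) hB

section Composition

variable {R : Type*} [CommRing R] {ψ : PowerSeries R}

lemma coeff_pow_of_lt (h0 : PowerSeries.constantCoeff ψ = 0) {n i : ℕ} (h : n < i) :
    PowerSeries.coeff n (ψ ^ i) = 0 :=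
  PowerSeries.X_pow_dvd_iff.1 (pow_dvd_pow_of_dvd (PowerSeries.X_dvd_iff.2 h0) i) n h

lemma coeff_pow_self (h0 : PowerSeries.constantCoeff ψ = 0) (i : ℕ) :
    PowerSeries.coeff i (ψ ^ i) = PowerSeries.coeff 1 ψ ^ i := by
  obtain ⟨g, rfl⟩ := PowerSeries.X_dvd_iff.2 h0
  have hg := PowerSeries.coeff_X_pow_mul (g ^ i) i 0
  rw [zero_add, PowerSeries.coeff_zero_eq_constantCoeff_apply, map_pow] at hg
  rw [mul_pow, hg, PowerSeries.coeff_succ_X_mul, PowerSeries.coeff_zero_eq_constantCoeff_apply]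

lemma coeff_subst_eq_sum (h0 : PowerSeries.constantCoeff ψ = 0) (F : PowerSeries R) (n : ℕ) :
    PowerSeries.coeff n (F.subst ψ)
      = ∑ i ∈ range (n + 1), PowerSeries.coeff i F * PowerSeries.coeff n (ψ ^ i) := by
  rw [PowerSeries.coeff_subst' (PowerSeries.HasSubst.of_constantCoeff_zero' h0)]
  refine finsum_eq_sum_of_support_subset _ fun i hi => ?_
  rw [coe_range, Set.mem_Iio]
  by_contra! h
  exact hi (by simp only [coeff_pow_of_lt h0 h, smul_zero])

lemma aeval_eq_subst (h0 : PowerSeries.constantCoeff ψ = 0) (F : R[X]) :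
    aeval ψ F = (F : PowerSeries R).subst ψ :=
  (PowerSeries.subst_coe (PowerSeries.HasSubst.of_constantCoeff_zero' h0) F).symm

end Composition

section Growth

variable {L : Type*} [NormedField L]

lemma isLocallyAnalytic_iff {f : PowerSeries L} : IsLocallyAnalytic f ↔
    ∃ A r : ℝ, 0 < r ∧ ∀ n, ‖PowerSeries.coeff n f‖ ≤ A * r ^ n := by
  constructor
  · rintro ⟨s, hs, hf⟩
    obtain ⟨A, hA⟩ := ((PowerSeries.isRestricted_iff' _ _).1 hf).bddAbove_range
    refine ⟨A, s⁻¹, by positivity, fun n => ?_⟩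
    rw [inv_pow, ← div_eq_mul_inv, le_div_iff₀ (by positivity)]
    exact hA ⟨n, rfl⟩
  · rintro ⟨A, r, hr, hf⟩
    refine ⟨(2 * r)⁻¹, by positivity, (PowerSeries.isRestricted_iff' _ _).2 ?_⟩
    have hlim : Filter.Tendsto (fun n : ℕ => A * (1 / 2 : ℝ) ^ n) Filter.atTop (nhds 0) := by
      simpa using
        (tendsto_pow_atTop_nhds_zero_of_lt_one one_half_pos.le one_half_lt_one).const_mul A
    refine squeeze_zero (fun n => by positivity) (fun n => ?_) hlim
    calc ‖PowerSeries.coeff n f‖ * (2 * r)⁻¹ ^ n ≤ A * r ^ n * (2 * r)⁻¹ ^ n :=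
          mul_le_mul_of_nonneg_right (hf n) (by positivity)
      _ = A * (1 / 2 : ℝ) ^ n := by
          rw [mul_assoc, ← mul_pow]
          congr 2
          field_simp

lemma IsLocallyAnalytic.exists_norm_coeff_le {f : PowerSeries L} (hf : IsLocallyAnalytic f)
    (h0 : PowerSeries.constantCoeff f = 0) (h1 : PowerSeries.coeff 1 f ≠ 0) :
    ∃ r : ℝ, 0 < r ∧
      ∀ n, ‖PowerSeries.coeff n f‖ ≤ ‖PowerSeries.coeff 1 f‖ / r * r ^ n := by
  obtain ⟨A, r, hr, hA⟩ := isLocallyAnalytic_iff.1 hf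
  let b := ‖PowerSeries.coeff 1 f‖
  have hb : 0 < b := norm_pos_iff.2 h1
  let D := max 1 (A * r / b)
  have hD : 1 ≤ D := le_max_left _ _
  refine ⟨D * r, by positivity, fun n => ?_⟩
  match n with
  | 0 => rw [PowerSeries.coeff_zero_eq_constantCoeff_apply, h0, norm_zero]; positivity
  | 1 => rw [pow_one, div_mul_cancel₀ _ (by positivity)]
  | n + 2 =>
    calc ‖PowerSeries.coeff (n + 2) f‖ ≤ A * r ^ (n + 2) := hA _
      _ = b * (A * r / b) * r ^ (n + 1) := by rw [pow_succ' r (n + 1)]; field_simp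
      _ ≤ b * D ^ (n + 1) * r ^ (n + 1) := by
          gcongr
          exact (le_max_right _ _).trans (le_self_pow₀ hD n.succ_ne_zero)
      _ = b / (D * r) * (D * r) ^ (n + 2) := by
          rw [pow_succ (D * r) (n + 1), mul_pow]; field_simp

variable [IsUltrametricDist L] {r A B : ℝ} {F G : PowerSeries L}

lemma norm_coeff_mul_le (hr : 0 ≤ r) (hA : 0 ≤ A) (hB : 0 ≤ B)
    (hF : ∀ n, ‖PowerSeries.coeff n F‖ ≤ A * r ^ n) (hG : ∀ n, ‖PowerSeries.coeff n G‖ ≤ B * r ^ n)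
    (n : ℕ) : ‖PowerSeries.coeff n (F * G)‖ ≤ A * B * r ^ n := by
  rw [PowerSeries.coeff_mul]
  refine IsUltrametricDist.norm_sum_le_of_forall_le_of_nonneg (by positivity) fun x hx => ?_
  rw [norm_mul, ← mem_antidiagonal.1 hx, pow_add, mul_mul_mul_comm]
  exact mul_le_mul (hF _) (hG _) (norm_nonneg _) (by positivity)

lemma norm_coeff_pow_le (hr : 0 ≤ r) (hA : 0 ≤ A) (hF : ∀ n, ‖PowerSeries.coeff n F‖ ≤ A * r ^ n)
    (i n : ℕ) : ‖PowerSeries.coeff n (F ^ i)‖ ≤ A ^ i * r ^ n := by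
  induction i generalizing n with
  | zero =>
    rw [pow_zero, PowerSeries.coeff_one, pow_zero, one_mul]
    split_ifs with h
    · simp [h]
    · rw [norm_zero]; positivity
  | succ i ih =>
    rw [pow_succ, pow_succ]
    exact norm_coeff_mul_le hr (by positivity) hA ih hF n

lemma exists_norm_coeff_aeval_le (hr : 0 ≤ r) (hA : 0 ≤ A)
    (hF : ∀ n, ‖PowerSeries.coeff n F‖ ≤ A * r ^ n) (P : L[X]) :
    ∃ B : ℝ, 0 ≤ B ∧ ∀ n, ‖PowerSeries.coeff n (aeval F P)‖ ≤ B * r ^ n := by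
  induction P using Polynomial.induction_on' with
  | add P Q hP hQ =>
    obtain ⟨B, hB, hBP⟩ := hP
    obtain ⟨B', _, hBQ⟩ := hQ
    refine ⟨max B B', le_max_of_le_left hB, fun n => ?_⟩
    rw [map_add, map_add]
    exact norm_add_le_of_norm_le
      ((hBP n).trans (mul_le_mul_of_nonneg_right (le_max_left _ _) (by positivity)))
      ((hBQ n).trans (mul_le_mul_of_nonneg_right (le_max_right _ _) (by positivity)))
  | monomial i a =>
    refine ⟨‖a‖ * A ^ i, by positivity, fun n => ?_⟩
    rw [aeval_monomial, ← Algebra.smul_def, map_smul, norm_smul, mul_assoc]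
    exact mul_le_mul_of_nonneg_left (norm_coeff_pow_le hr hA hF i n) (norm_nonneg _)

/-- Composition with `ψ` is triangular, with diagonal entries the powers of `coeff 1 ψ`, so the
coefficients of `F` can be recovered from those of `F ∘ ψ`. -/
lemma norm_coeff_le_of_norm_coeff_subst_le {ψ : PowerSeries L} (hr : 0 < r) (hB : 0 ≤ B)
    (h0 : PowerSeries.constantCoeff ψ = 0) (h1 : PowerSeries.coeff 1 ψ ≠ 0)
    (hψ : ∀ n, ‖PowerSeries.coeff n ψ‖ ≤ ‖PowerSeries.coeff 1 ψ‖ / r * r ^ n)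
    (hF : ∀ n, ‖PowerSeries.coeff n (F.subst ψ)‖ ≤ B * r ^ n) (n : ℕ) :
    ‖PowerSeries.coeff n F‖ ≤ B * (r / ‖PowerSeries.coeff 1 ψ‖) ^ n := by
  let b := ‖PowerSeries.coeff 1 ψ‖
  have hb : 0 < b := norm_pos_iff.2 h1
  induction n using Nat.strong_induction_on with
  | _ n ih =>
    have hn := hF n
    rw [coeff_subst_eq_sum h0, sum_range_succ, coeff_pow_self h0] at hn
    have hlow : ‖∑ i ∈ range n, PowerSeries.coeff i F * PowerSeries.coeff n (ψ ^ i)‖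
        ≤ B * r ^ n := by
      refine IsUltrametricDist.norm_sum_le_of_forall_le_of_nonneg (by positivity) fun i hi => ?_
      rw [norm_mul]
      calc _ ≤ B * (r / b) ^ i * ((b / r) ^ i * r ^ n) :=
            mul_le_mul (ih i (mem_range.1 hi))
              (norm_coeff_pow_le hr.le (by positivity) hψ i n) (norm_nonneg _) (by positivity)
        _ = B * r ^ n := by rw [div_pow, div_pow]; field_simp
    have hdiag := norm_sub_le_of_norm_le hn hlow
    rw [add_sub_cancel_left, norm_mul, norm_pow] at hdiag
    rw [div_pow, mul_div_assoc', le_div_iff₀ (by positivity)]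
    exact hdiag

lemma IsLocallyAnalytic.of_subst {ψ : PowerSeries L} (hψ : IsLocallyAnalytic ψ)
    (h0 : PowerSeries.constantCoeff ψ = 0) (h1 : PowerSeries.coeff 1 ψ ≠ 0)
    (hF : F.subst ψ = PowerSeries.X) : IsLocallyAnalytic F := by
  obtain ⟨r, hr, hψr⟩ := hψ.exists_norm_coeff_le h0 h1
  refine isLocallyAnalytic_iff.2 ⟨r⁻¹, _, by positivity,
    norm_coeff_le_of_norm_coeff_subst_le hr (inv_nonneg.2 hr.le) h0 h1 hψr fun n => ?_⟩
  rw [hF, PowerSeries.coeff_X]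
  split_ifs with hn
  · rw [hn, pow_one, inv_mul_cancel₀ hr.ne', norm_one]
  · rw [norm_zero]; positivity

end Growth

section PoincareSeries

variable {L : Type*} [NormedField L]

/-- `f` has a Poincaré series: there is a locally analytic local coordinate change `ψ` with
`f ∘ ψ = ψ(λ ·)`, that is, an inverse of a linearization of `f`. -/
def HasPoincareSeries (lam : L) (f : L[X]) : Prop :=
  ∃ ψ : PowerSeries L, IsLocallyAnalytic ψ ∧ PowerSeries.constantCoeff ψ = 0 ∧
    PowerSeries.coeff 1 ψ ≠ 0 ∧ aeval ψ f = PowerSeries.rescale lam ψ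

lemma IsLinearizable.hasPoincareSeries [IsUltrametricDist L] {f : L[X]} (hf0 : f.coeff 0 = 0)
    (hf : IsLinearizable (f : PowerSeries L)) : HasPoincareSeries (f.coeff 1) f := by
  obtain ⟨h, hb, hh, h0, hfh⟩ := hf
  let ψ := h.substInvOfIsUnit hb
  have hψ0 : PowerSeries.constantCoeff ψ = 0 := PowerSeries.constantCoeff_substInvOfIsUnit _ _
  have hψh : ψ.subst h = PowerSeries.X := PowerSeries.subst_substInvOfIsUnit_left _ h0 hb
  have hψ1 : PowerSeries.coeff 1 ψ ≠ 0 := by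
    rw [PowerSeries.coeff_one_substInvOfIsUnit]
    exact Units.ne_zero _
  refine ⟨ψ, hh.of_subst h0 hb.ne_zero hψh, hψ0, hψ1, ?_⟩
  have hfψ0 : PowerSeries.constantCoeff ((f : PowerSeries L).subst ψ) = 0 :=
    PowerSeries.constantCoeff_subst_eq_zero hψ0 _ (by simpa using hf0)
  have hfψ := PowerSeries.HasSubst.of_constantCoeff_zero' hfψ0
  rw [aeval_eq_subst hψ0, PowerSeries.rescale_eq_subst, PowerSeries.smul_eq_C_mul]
  calc (f : PowerSeries L).subst ψ = ψ.subst (h.subst ((f : PowerSeries L).subst ψ)) := by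
        rw [← PowerSeries.subst_comp_subst_apply
          (PowerSeries.HasSubst.of_constantCoeff_zero' h0) hfψ, hψh, PowerSeries.subst_X hfψ]
    _ = _ := by rw [hfh, coeff_coe]

lemma HasPoincareSeries.map {L' : Type*} [NormedField L'] {φ : L →+* L'} (hφ : ∀ x, ‖φ x‖ = ‖x‖)
    {lam : L} {f : L[X]} (h : HasPoincareSeries lam f) : HasPoincareSeries (φ lam) (f.map φ) := by
  obtain ⟨ψ, hψ, h0, h1, hf⟩ := h
  refine ⟨PowerSeries.map φ ψ, ?_, ?_, ?_, ?_⟩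
  · simpa only [isLocallyAnalytic_iff, PowerSeries.coeff_map, hφ] using hψ
  · rw [← PowerSeries.coeff_zero_eq_constantCoeff_apply, PowerSeries.coeff_map,
      PowerSeries.coeff_zero_eq_constantCoeff_apply, h0, map_zero]
  · rw [PowerSeries.coeff_map]
    exact (map_ne_zero φ).2 h1
  · have hcomp : (PowerSeries.map φ).comp (algebraMap L (PowerSeries L))
        = (algebraMap L' (PowerSeries L')).comp φ := by
      ext x : 1
      simp
    rw [aeval_def, eval₂_map, ← hcomp, ← hom_eval₂, ← aeval_def, hf]
    ext n
    simp

lemma HasPoincareSeries.scale {lam : L} {f : L[X]} (h : HasPoincareSeries lam f) {ρ : L}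
    (hρ : ρ ≠ 0) : HasPoincareSeries lam (C ρ⁻¹ * f.comp (C ρ * X)) := by
  obtain ⟨ψ, hψ, h0, h1, hf⟩ := h
  refine ⟨ρ⁻¹ • ψ, ?_, ?_, ?_, ?_⟩
  · obtain ⟨A, r, hr, hA⟩ := isLocallyAnalytic_iff.1 hψ
    refine isLocallyAnalytic_iff.2 ⟨‖ρ⁻¹‖ * A, r, hr, fun n => ?_⟩
    rw [map_smul, norm_smul, mul_assoc]
    exact mul_le_mul_of_nonneg_left (hA n) (norm_nonneg _)
  · simp [PowerSeries.smul_eq_C_mul, h0]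
  · rw [map_smul]
    exact smul_ne_zero (inv_ne_zero hρ) h1
  · have hX : aeval (ρ⁻¹ • ψ) (C ρ * X) = ψ := by
      rw [← smul_eq_C_mul, map_smul, aeval_X, smul_inv_smul₀ hρ]
    rw [← smul_eq_C_mul, map_smul, aeval_comp, hX, hf]
    ext n
    simp only [map_smul, PowerSeries.coeff_rescale, smul_eq_mul]
    ring

variable [IsUltrametricDist L] {lam : L} {f : L[X]}

lemma HasPoincareSeries.exists_norm_coeff_compOp_qFalling_le (hf : HasPoincareSeries lam f)
    (hlam : ‖lam‖ ≤ 1) (F : L[X]) :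
    ∃ B r : ℝ, 0 ≤ B ∧ 0 < r ∧ ∀ N n,
      ‖(compOp f (qFalling lam 0 N) F).coeff n‖ ≤ B * r ^ n * ‖qRising lam 1 N‖ := by
  obtain ⟨ψ, hψ, h0, h1, hfψ⟩ := hf
  obtain ⟨r, hr, hψr⟩ := hψ.exists_norm_coeff_le h0 h1
  obtain ⟨B, hB, hBF⟩ := exists_norm_coeff_aeval_le hr.le (by positivity) hψr F
  refine ⟨B, r / ‖PowerSeries.coeff 1 ψ‖, hB, div_pos hr (norm_pos_iff.2 h1), fun N n => ?_⟩
  rw [mul_right_comm, ← coeff_coe]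
  refine norm_coeff_le_of_norm_coeff_subst_le hr (by positivity) h0 h1 hψr (fun n => ?_) n
  rw [← aeval_eq_subst h0, coeff_aeval_compOp hfψ, norm_mul, mul_comm, mul_right_comm]
  exact mul_le_mul (hBF n) (norm_eval_pow_qFalling_le hlam N n) (norm_nonneg _) (by positivity)

/-- The `λ`-factorials decay superexponentially because the norm of `λⁿ - 1` is a `p`-power of
that of `λ - 1`. -/
lemma HasPoincareSeries.not_forall_pow_le {p : ℕ} [hp : Fact p.Prime] [CharP L p]
    (hf : HasPoincareSeries lam f) (hlam : ‖lam - 1‖ < 1) {m : ℕ} (hm : 0 < m) (F : L[X])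
    (e₀ e₁ : ℕ) {θ : ℝ} (hθ : 0 < θ) :
    ¬ ∀ N, θ ^ N ≤ ‖(compOp f (qFalling lam 0 (N * m)) F).coeff (e₀ + N * e₁)‖ := by
  intro hlower
  obtain ⟨B, r, hB, hr, hupper⟩ := hf.exists_norm_coeff_compOp_qFalling_le
    (norm_eq_one_of_norm_sub_one_lt hlam).le F
  let D := r ^ e₁ * ‖qRising lam 1 m‖ / θ
  obtain ⟨k, hk⟩ := exists_mul_pow_lt_one (norm_nonneg (lam - 1)) hlam (B := B * r ^ e₀)
    (D := D) (by positivity) (by positivity) hp.out.one_lt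
  have hle : θ ^ p ^ k ≤ θ ^ p ^ k
      * (B * r ^ e₀ * D ^ p ^ k * ‖lam - 1‖ ^ (k * p ^ (k - 1))) :=
    calc θ ^ p ^ k ≤ B * r ^ (e₀ + p ^ k * e₁) * ‖qRising lam 1 (p ^ k * m)‖ :=
          (hlower _).trans (hupper _ _)
      _ ≤ B * r ^ (e₀ + p ^ k * e₁) *
          (‖qRising lam 1 m‖ ^ p ^ k * ‖lam - 1‖ ^ (k * p ^ (k - 1))) :=
          mul_le_mul_of_nonneg_left (norm_qRising_prime_pow_mul_le hlam hm k) (by positivity)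
      _ = _ := by
          rw [div_pow, mul_pow, pow_add, ← pow_mul r e₁, mul_comm e₁]
          field_simp
  exact hle.not_gt (mul_lt_of_lt_one_right (by positivity) hk)

end PoincareSeries

section CoeffBound

variable {L : Type*} [NormedField L] {A B : ℝ} {F G : L[X]}

/-- The Gauss norm of `F` is at most `B`. -/
def CoeffLE (B : ℝ) (F : L[X]) : Prop := ∀ i, ‖F.coeff i‖ ≤ B

lemma CoeffLE.nonneg (h : CoeffLE B F) : 0 ≤ B := (norm_nonneg _).trans (h 0)

lemma CoeffLE.mono (h : CoeffLE A F) (hAB : A ≤ B) : CoeffLE B F := fun i => (h i).trans hAB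

lemma coeffLE_smul_iff {c : L} (hc : c ≠ 0) : CoeffLE (‖c‖ * B) (c • F) ↔ CoeffLE B F := by
  simp only [CoeffLE, coeff_smul, norm_smul, mul_le_mul_iff_right₀ (norm_pos_iff.2 hc)]

lemma CoeffLE.smul (h : CoeffLE B F) (c : L) : CoeffLE (‖c‖ * B) (c • F) := fun i => by
  rw [coeff_smul, norm_smul]
  exact mul_le_mul_of_nonneg_left (h i) (norm_nonneg c)

lemma coeffLE_zero (hB : 0 ≤ B) : CoeffLE B (0 : L[X]) := fun i => by simpa using hB

lemma coeffLE_X_pow (n : ℕ) : CoeffLE 1 (X ^ n : L[X]) := fun i => by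
  rw [coeff_X_pow]
  split_ifs <;> simp

lemma coeffLE_X : CoeffLE 1 (X : L[X]) := by simpa using coeffLE_X_pow (L := L) 1

variable [IsUltrametricDist L]

lemma CoeffLE.add (hF : CoeffLE B F) (hG : CoeffLE B G) : CoeffLE B (F + G) := fun i => by
  rw [coeff_add]
  exact norm_add_le_of_norm_le (hF i) (hG i)

lemma CoeffLE.sub (hF : CoeffLE B F) (hG : CoeffLE B G) : CoeffLE B (F - G) := fun i => by
  rw [coeff_sub]
  exact norm_sub_le_of_norm_le (hF i) (hG i)

lemma coeffLE_sum {ι : Type*} {s : Finset ι} {F : ι → L[X]} (hB : 0 ≤ B)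
    (h : ∀ i ∈ s, CoeffLE B (F i)) : CoeffLE B (∑ i ∈ s, F i) := fun n => by
  rw [finsetSum_coeff]
  exact IsUltrametricDist.norm_sum_le_of_forall_le_of_nonneg hB fun i hi => h i hi n

lemma CoeffLE.mul (hF : CoeffLE A F) (hG : CoeffLE B G) : CoeffLE (A * B) (F * G) := fun n => by
  rw [coeff_mul]
  refine IsUltrametricDist.norm_sum_le_of_forall_le_of_nonneg
    (mul_nonneg hF.nonneg hG.nonneg) fun x _ => ?_
  rw [norm_mul]
  exact mul_le_mul (hF _) (hG _) (norm_nonneg _) hF.nonneg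

lemma CoeffLE.mul_integral (hF : CoeffLE B F) (hG : CoeffLE 1 G) : CoeffLE B (F * G) :=
  mul_one B ▸ hF.mul hG

lemma CoeffLE.integral_mul (hF : CoeffLE 1 F) (hG : CoeffLE B G) : CoeffLE B (F * G) :=
  one_mul B ▸ hF.mul hG

lemma CoeffLE.pow (hF : CoeffLE 1 F) (n : ℕ) : CoeffLE 1 (F ^ n) := by
  induction n with
  | zero => simpa using coeffLE_X_pow (L := L) 0
  | succ n ih => rw [pow_succ]; exact ih.mul_integral hF

lemma norm_coeff_derivative_le (F : L[X]) (n : ℕ) :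
    ‖(derivative F).coeff n‖ ≤ ‖F.coeff (n + 1)‖ := by
  rw [coeff_derivative, norm_mul]
  refine mul_le_of_le_one_right (norm_nonneg _) ?_
  exact_mod_cast IsUltrametricDist.norm_natCast_le_one L (n + 1)

lemma CoeffLE.derivative (hF : CoeffLE B F) : CoeffLE B (Polynomial.derivative F) := fun n =>
  (norm_coeff_derivative_le F n).trans (hF _)

lemma CoeffLE.norm_eval_le (hF : CoeffLE B F) {x : L} (hx : ‖x‖ ≤ 1) : ‖F.eval x‖ ≤ B := by
  rw [eval_eq_sum_range]
  refine IsUltrametricDist.norm_sum_le_of_forall_le_of_nonneg hF.nonneg fun i _ => ?_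
  rw [norm_mul, norm_pow]
  exact (mul_le_of_le_one_right (norm_nonneg _) (pow_le_one₀ (norm_nonneg _) hx)).trans (hF _)

/-- The vector field `a ∂`, as an operator on polynomials. -/
noncomputable def vectorField {R : Type*} [CommRing R] (a : R[X]) : Module.End R R[X] :=
  LinearMap.mulLeft R a ∘ₗ derivative

lemma vectorField_apply {R : Type*} [CommRing R] (a F : R[X]) :
    vectorField a F = a * derivative F := rfl

lemma coeffLE_vectorField (hF : CoeffLE A F) (hG : CoeffLE B G) :
    CoeffLE (A * B) (vectorField F G) := hF.mul hG.derivative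

lemma CoeffLE.map {τ : ℝ} {T : Module.End L L[X]} (hT : ∀ n, CoeffLE τ (T (X ^ n)))
    (hF : CoeffLE B F) : CoeffLE (τ * B) (T F) := by
  have hτ := (hT 0).nonneg
  rw [F.as_sum_range_C_mul_X_pow, map_sum]
  refine coeffLE_sum (mul_nonneg hτ hF.nonneg) fun i _ => ?_
  rw [← smul_eq_C_mul, map_smul]
  refine ((hT i).smul _).mono ?_
  rw [mul_comm]
  exact mul_le_mul_of_nonneg_left (hF i) hτ

/-- An operator which is approximately a derivation is approximately a vector field. -/
lemma CoeffLE.map_sub_vectorField {τ : ℝ} {T : Module.End L L[X]} (h1 : T 1 = 0)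
    (hT : ∀ n, CoeffLE τ (T (X ^ (n + 1)) - X * T (X ^ n) - X ^ n * T X)) (hF : CoeffLE B F) :
    CoeffLE (τ * B) (T F - vectorField (T X) F) := by
  refine CoeffLE.map (T := T - vectorField (T X)) (fun n => ?_) hF
  simp only [LinearMap.sub_apply, vectorField_apply]
  induction n with
  | zero => simpa [h1] using coeffLE_zero (hT 0).nonneg
  | succ n ih =>
    have hsplit : T (X ^ (n + 1)) - T X * Polynomial.derivative (X ^ (n + 1))
        = (T (X ^ (n + 1)) - X * T (X ^ n) - X ^ n * T X)
          + X * (T (X ^ n) - T X * Polynomial.derivative (X ^ n)) := by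
      rw [pow_succ, derivative_mul, derivative_X]; ring
    rw [hsplit]
    exact (hT n).add (coeffLE_X.integral_mul ih)

end CoeffBound

section ReducedOrder

variable {L : Type*} [NormedField L] {A B : ℝ} {F G : L[X]} {i j : ℕ}

/-- The Gauss norm of `F` is at most `B` and the coefficients of index less than `d` have smaller
norm: scaled to Gauss norm one, the reduction of `F` to the residue field has order at least `d`. -/
structure ReducedOrderGE (B : ℝ) (d : ℕ) (F : L[X]) : Prop where
  coeffLE : CoeffLE B F
  norm_coeff_lt : ∀ i < d, ‖F.coeff i‖ < B

lemma exists_reducedOrderGE (F : L[X]) : ∃ d, ReducedOrderGE ‖F.coeff d‖ d F := by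
  classical
  obtain ⟨k, -, hk⟩ := exists_max_image (range (F.natDegree + 1)) (fun i => ‖F.coeff i‖)
    ⟨0, by simp⟩
  have hmax : CoeffLE ‖F.coeff k‖ F := fun i => by
    rcases Nat.lt_or_ge F.natDegree i with h | h
    · simp [coeff_eq_zero_of_natDegree_lt h]
    · exact hk i (mem_range.2 (by omega))
  have hex : ∃ d, ‖F.coeff d‖ = ‖F.coeff k‖ := ⟨k, rfl⟩
  refine ⟨Nat.find hex, ?_⟩
  rw [Nat.find_spec hex]
  exact ⟨hmax, fun i hi => (hmax i).lt_of_ne (Nat.find_min hex hi)⟩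

lemma reducedOrderGE_X : ReducedOrderGE 1 1 (X : L[X]) :=
  ⟨coeffLE_X, fun i hi => by simp [Nat.lt_one_iff.1 hi]⟩

lemma ReducedOrderGE.norm_mul_lt (hA : 0 < A) (hB : 0 < B) (hF : ReducedOrderGE A i F)
    (hG : ReducedOrderGE B j G) {k l : ℕ} (hkl : k < i ∨ l < j) :
    ‖F.coeff k * G.coeff l‖ < A * B := by
  rw [norm_mul]
  rcases hkl with hk | hl
  · exact (mul_le_mul_of_nonneg_left (hG.coeffLE l) (norm_nonneg _)).trans_lt
      (mul_lt_mul_of_pos_right (hF.norm_coeff_lt k hk) hB)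
  · exact (mul_le_mul_of_nonneg_right (hF.coeffLE k) (norm_nonneg _)).trans_lt
      (mul_lt_mul_of_pos_left (hG.norm_coeff_lt l hl) hA)

variable [IsUltrametricDist L]

lemma ReducedOrderGE.derivative (hF : ReducedOrderGE B (i + 1) F) :
    ReducedOrderGE B i (Polynomial.derivative F) :=
  ⟨hF.coeffLE.derivative, fun k hk =>
    (norm_coeff_derivative_le F k).trans_lt (hF.norm_coeff_lt _ (by omega))⟩

lemma ReducedOrderGE.of_sub {δ : ℝ} (hF : ReducedOrderGE B i F) (h : CoeffLE δ (G - F))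
    (hδ : δ < B) : ReducedOrderGE B i G := by
  rw [← sub_add_cancel G F]
  exact ⟨(h.mono hδ.le).add hF.coeffLE, fun k hk => by
    rw [coeff_add]
    exact norm_add_lt_of_norm_lt ((h k).trans_lt hδ) (hF.norm_coeff_lt k hk)⟩

/-- Gauss's lemma: the lowest coefficients of the reductions multiply. -/
lemma ReducedOrderGE.norm_coeff_mul_sub_lt (hA : 0 < A) (hB : 0 < B) (hF : ReducedOrderGE A i F)
    (hG : ReducedOrderGE B j G) :
    ‖(F * G).coeff (i + j) - F.coeff i * G.coeff j‖ < A * B := by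
  rw [coeff_mul, ← add_sum_erase _ _ (mem_antidiagonal.2 rfl : (i, j) ∈ antidiagonal (i + j)),
    add_sub_cancel_left]
  refine norm_sum_lt_of_forall_lt (mul_pos hA hB) fun x hx => hF.norm_mul_lt hA hB hG ?_
  simp only [mem_erase, ne_eq, Prod.ext_iff, HasAntidiagonal.mem_antidiagonal] at hx
  omega

lemma ReducedOrderGE.mul (hA : 0 < A) (hB : 0 < B) (hF : ReducedOrderGE A i F)
    (hG : ReducedOrderGE B j G) : ReducedOrderGE (A * B) (i + j) (F * G) := by
  refine ⟨hF.coeffLE.mul hG.coeffLE, fun n hn => ?_⟩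
  rw [coeff_mul]
  refine norm_sum_lt_of_forall_lt (mul_pos hA hB) fun x hx => hF.norm_mul_lt hA hB hG ?_
  have := HasAntidiagonal.mem_antidiagonal.1 hx
  omega

end ReducedOrder

section Taylor

variable {L : Type*} [NormedField L] [IsUltrametricDist L] {f F : L[X]} {B δ : ℝ}

lemma CoeffLE.comp (hF : CoeffLE B F) (hf : CoeffLE 1 f) : CoeffLE B (F.comp f) := by
  have hT := CoeffLE.map (T := compOp f X) (τ := 1) (fun n => ?_) hF
  · rwa [compOp_X, one_mul] at hT
  · rw [compOp_X, X_pow_comp]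
    exact hf.pow n

lemma CoeffLE.comp_sub (hF : CoeffLE B F) (hf : CoeffLE 1 f) (hδ : CoeffLE δ (f - X)) :
    CoeffLE (δ * B) (F.comp f - F) := by
  have hT := CoeffLE.map (T := compOp f (X - C 1)) (τ := δ) (fun n => ?_) hF
  · rwa [compOp_X_sub_C, one_smul] at hT
  rw [compOp_X_sub_C, one_smul, X_pow_comp]
  induction n with
  | zero => simpa using coeffLE_zero hδ.nonneg
  | succ n ih =>
    have hsplit : f ^ (n + 1) - X ^ (n + 1) = (f ^ n - X ^ n) * f + X ^ n * (f - X) := by ring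
    rw [hsplit]
    exact (ih.mul_integral hf).add ((coeffLE_X_pow n).integral_mul hδ)

lemma CoeffLE.comp_sub_vectorField (hF : CoeffLE B F) (hf : CoeffLE 1 f)
    (hδ : CoeffLE δ (f - X)) :
    CoeffLE (δ * δ * B) (F.comp f - F - vectorField (f - X) F) := by
  have hX : compOp f (X - C 1) X = f - X := by rw [compOp_X_sub_C, X_comp, one_smul]
  have hT := CoeffLE.map_sub_vectorField (T := compOp f (X - C 1)) (τ := δ * δ)
    (by rw [compOp_X_sub_C, one_comp, one_smul, sub_self]) (fun n => ?_) hF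
  · rwa [hX, compOp_X_sub_C, one_smul] at hT
  · have hprod : compOp f (X - C 1) (X ^ (n + 1)) - X * compOp f (X - C 1) (X ^ n)
        - X ^ n * compOp f (X - C 1) X = (f - X) * (f ^ n - X ^ n) := by
      simp only [compOp_X_sub_C, X_pow_comp, X_comp, one_smul]
      ring
    rw [hprod]
    have h := (coeffLE_X_pow n).comp_sub hf hδ
    rw [X_pow_comp, mul_one] at h
    exact hδ.mul h

lemma CoeffLE.compOp_X_pow (hF : CoeffLE B F) (hf : CoeffLE 1 f) (j : ℕ) :
    CoeffLE B (compOp f (X ^ j) F) := by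
  induction j with
  | zero => rwa [pow_zero, compOp_one]
  | succ j ih =>
    rw [pow_succ', compOp_mul, compOp_X]
    exact ih.comp hf

lemma CoeffLE.compOp_X_pow_sub (hF : CoeffLE B F) (hf : CoeffLE 1 f) (hδ : CoeffLE δ (f - X))
    (j : ℕ) : CoeffLE (δ * B) (compOp f (X ^ j) F - F) := by
  induction j with
  | zero =>
    rw [pow_zero, compOp_one, sub_self]
    exact coeffLE_zero (mul_nonneg hδ.nonneg hF.nonneg)
  | succ j ih =>
    rw [pow_succ', compOp_mul, compOp_X, ← sub_add_sub_cancel]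
    exact ((hF.compOp_X_pow hf j).comp_sub hf hδ).add ih

end Taylor

section Integrality

variable {L : Type*} [NormedField L] [IsUltrametricDist L] {lam : L} {f g F : L[X]} {B M δ : ℝ}
  {m : ℕ}

lemma CoeffLE.compOp_qChoose (hF : CoeffLE B F) (hroot : ∀ n : ℕ, 0 < n → lam ^ n ≠ 1)
    (hf : CoeffLE 1 f) (hlt : ∀ j < m, CoeffLE 1 (compOp f (qChoose lam j) X)) {j : ℕ}
    (hj : j < m) : CoeffLE B (compOp f (qChoose lam j) F) := by
  refine one_mul B ▸ CoeffLE.map (fun n => ?_) hF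
  induction n generalizing j with
  | zero =>
    rcases Nat.eq_zero_or_pos j with rfl | hj0
    · rw [qChoose_zero, compOp_one]
      exact coeffLE_X_pow 0
    · rw [pow_zero, compOp_qChoose_one hj0]
      exact coeffLE_zero zero_le_one
  | succ n ih =>
    rw [pow_succ, compOp_qChoose_mul hroot]
    refine coeffLE_sum zero_le_one fun x hx => ?_
    have hx := mem_antidiagonal.1 hx
    rw [compOp_mul]
    exact ((ih (by omega)).compOp_X_pow hf _).mul_integral (hlt _ (by omega))

/-- By the `λ`-Leibniz rule, the first operator which is not integral is close to a vector field. -/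
lemma CoeffLE.compOp_qChoose_sub_vectorField (hF : CoeffLE B F)
    (hroot : ∀ n : ℕ, 0 < n → lam ^ n ≠ 1) (hf : CoeffLE 1 f) (hδ : CoeffLE δ (f - X)) (hm : 0 < m)
    (hlt : ∀ j < m, CoeffLE 1 (compOp f (qChoose lam j) X))
    (hM : CoeffLE M (compOp f (qChoose lam m) X)) :
    CoeffLE (max 1 (δ * M) * B) (compOp f (qChoose lam m) F
      - vectorField (compOp f (qChoose lam m) X) F) := by
  refine hF.map_sub_vectorField (compOp_qChoose_one hm) fun n => ?_
  have h₁ : (m, 0) ∈ antidiagonal m := by simp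
  have h₂ : (0, m) ∈ (antidiagonal m).erase (m, 0) := by simp; omega
  rw [pow_succ, compOp_qChoose_mul hroot, ← add_sum_erase _ _ h₁, ← add_sum_erase _ _ h₂]
  simp only [pow_zero, one_mul, mul_one, qChoose_zero, compOp_one]
  rw [mul_comm X, add_sub_cancel_left, add_sub_right_comm, ← sub_mul]
  refine CoeffLE.add ?_ ((coeffLE_sum zero_le_one fun x hx => ?_).mono (le_max_left _ _))
  · have h := ((coeffLE_X_pow n).compOp_X_pow_sub hf hδ m).mul hM
    rw [mul_one] at h
    exact h.mono (le_max_right _ _)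
  · simp only [mem_erase, ne_eq, Prod.ext_iff, HasAntidiagonal.mem_antidiagonal] at hx
    rw [compOp_mul]
    exact (((coeffLE_X_pow n).compOp_qChoose hroot hf hlt (by omega)).compOp_X_pow hf
      _).mul_integral (hlt _ (by omega))

lemma CoeffLE.compOp_qFalling_sub_vectorField (hF : CoeffLE B F)
    (hroot : ∀ n : ℕ, 0 < n → lam ^ n ≠ 1) (hlam : ‖lam‖ ≤ 1) (hf : CoeffLE 1 f)
    (hδ : CoeffLE δ (f - X)) (hm : 0 < m) (hlt : ∀ j < m, CoeffLE 1 (compOp f (qChoose lam j) X))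
    (hM : CoeffLE M (compOp f (qChoose lam m) X)) (t : ℕ) :
    CoeffLE (max 1 (δ * M) * B) ((qRising lam 1 m)⁻¹ • compOp f (qFalling lam t m) F
      - vectorField (compOp f (qChoose lam m) X) F) := by
  have h₀ : (0, m) ∈ antidiagonal m := by simp
  rw [qFalling_eq_sum_qChoose hroot, map_smul, LinearMap.smul_apply,
    inv_smul_smul₀ (qRising_one_ne_zero hroot m), map_sum, LinearMap.sum_apply,
    ← add_sum_erase _ _ h₀, qVandermondeCoeff_zero, one_smul, add_sub_right_comm]
  refine (hF.compOp_qChoose_sub_vectorField hroot hf hδ hm hlt hM).add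
    ((coeffLE_sum hF.nonneg fun x hx => ?_).mono
      (le_mul_of_one_le_left hF.nonneg (le_max_left _ _)))
  simp only [mem_erase, ne_eq, Prod.ext_iff, HasAntidiagonal.mem_antidiagonal] at hx
  rw [map_smul, LinearMap.smul_apply]
  exact ((hF.compOp_qChoose hroot hf hlt (by omega)).smul _).mono
    (mul_le_of_le_one_left hF.nonneg (norm_qVandermondeCoeff_le_one hlam _ _))

/-- Since `compOp f (qChoose lam m)` commutes with composition with `f`, the vector fields to which
these operators are close almost commute. -/
lemma coeffLE_commutator_vectorField (hroot : ∀ n : ℕ, 0 < n → lam ^ n ≠ 1) (hlam : ‖lam - 1‖ < 1)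
    (hfg : f = X + (lam - 1) • g) (hg : CoeffLE 1 g) (hm : 0 < m)
    (hlt : ∀ j < m, CoeffLE 1 (compOp f (qChoose lam j) X))
    (hM : CoeffLE M (compOp f (qChoose lam m) X)) :
    CoeffLE (max 1 (‖lam - 1‖ * M)) (vectorField (compOp f (qChoose lam m) X) g
      - vectorField g (compOp f (qChoose lam m) X)) := by
  let a := compOp f (qChoose lam m) X
  have hE : lam - 1 ≠ 0 := sub_ne_zero.2 (by simpa using hroot 1 one_pos)
  have hfX : f - X = (lam - 1) • g := by rw [hfg, add_sub_cancel_left]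
  have hδ : CoeffLE ‖lam - 1‖ (f - X) := by simpa only [hfX, mul_one] using hg.smul (lam - 1)
  have hf : CoeffLE 1 f := hfg ▸ coeffLE_X.add ((hg.smul (lam - 1)).mono (by linarith))
  have hcomm : a.comp f = a + (lam - 1) • compOp f (qChoose lam m) g := by
    rw [← compOp_X, ← compOp_mul, mul_comm, compOp_mul, compOp_X, X_comp, ← map_smul, ← map_add,
      ← hfg]
  have hgM : CoeffLE (‖lam - 1‖ * M) (compOp f (qChoose lam m) g - vectorField g a) := by
    have h := hM.comp_sub_vectorField hf hδ
    have hsplit : a.comp f - a - vectorField (f - X) a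
        = (lam - 1) • (compOp f (qChoose lam m) g - vectorField g a) := by
      rw [hcomm, hfX, add_sub_cancel_left, smul_sub, vectorField_apply, vectorField_apply,
        smul_mul_assoc]
    rwa [hsplit, mul_assoc, coeffLE_smul_iff hE] at h
  have hvf := hg.compOp_qChoose_sub_vectorField hroot hf hδ hm hlt hM
  rw [mul_one] at hvf
  simpa only [sub_sub_sub_cancel_left] using (hgM.mono (le_max_right _ _)).sub hvf

/-- If `a ∂` almost commutes with `g ∂ = (X + ⋯) ∂`, comparing the lowest coefficients of the
reduction of the commutator shows that the order `e + 1` of `a` is one in the residue field. -/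
lemma ReducedOrderGE.norm_natCast_mul_coeff_lt {a : L[X]} {e : ℕ} (hg : CoeffLE 1 g)
    (hg0 : g.coeff 0 = 0) (hg1 : g.coeff 1 = 1) (hM : 0 < M) (ha : ReducedOrderGE M (e + 1) a)
    (hcomm : CoeffLE δ (vectorField a g - vectorField g a)) (hδ : δ < M) :
    ‖(e : L) * a.coeff (e + 1)‖ < M := by
  have hg' : ReducedOrderGE 1 1 g := ⟨hg, fun i hi => by simp [Nat.lt_one_iff.1 hi, hg0]⟩
  have hag := ha.norm_coeff_mul_sub_lt hM one_pos hg'.derivative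
  have hga := hg'.norm_coeff_mul_sub_lt one_pos hM ha.derivative
  rw [coeff_derivative, hg1, Nat.cast_zero, zero_add, mul_one, mul_one, mul_one, add_zero] at hag
  rw [coeff_derivative, hg1, one_mul, one_mul, add_comm 1 e] at hga
  have hsplit : (e : L) * a.coeff (e + 1)
      = ((a * Polynomial.derivative g).coeff (e + 1) - a.coeff (e + 1))
        - ((g * Polynomial.derivative a).coeff (e + 1) - a.coeff (e + 1) * (e + 1))
        - (vectorField a g - vectorField g a).coeff (e + 1) := by
    rw [coeff_sub, vectorField_apply, vectorField_apply]
    ring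
  rw [hsplit]
  exact norm_sub_lt_of_norm_lt (norm_sub_lt_of_norm_lt hag hga) ((hcomm _).trans_lt hδ)

/-- Since `e = 0` in the field, differentiating `X ^ (1 + N * e)` does not lose the leading
coefficient, so that the iterates of the vector field `a ∂ = (cX ^ (e + 1) + ⋯) ∂` grow like
`‖c‖ ^ N`. -/
lemma reducedOrderGE_pow_of_forall_coeffLE_sub_vectorField {τ : ℝ} {a : L[X]} {e : ℕ}
    (he : (e : L) = 0) (ha : ReducedOrderGE M (e + 1) a) (hM : ‖a.coeff (e + 1)‖ = M) (hτ : τ < M)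
    {s : ℕ → L[X]} (hs0 : s 0 = X) (hs : ∀ N B, CoeffLE B (s N) →
      CoeffLE (τ * B) (s (N + 1) - vectorField a (s N))) (N : ℕ) :
    ReducedOrderGE (M ^ N) (1 + N * e) (s N) ∧ ‖(s N).coeff (1 + N * e)‖ = M ^ N := by
  have hM0 : 0 < M := (norm_nonneg _).trans_lt (ha.norm_coeff_lt 0 e.succ_pos)
  induction N with
  | zero => simpa [hs0] using reducedOrderGE_X
  | succ N ih =>
    obtain ⟨hN, hNe⟩ := ih
    have hpow : 0 < M ^ N := pow_pos hM0 N
    have hlt : τ * M ^ N < M * M ^ N := mul_lt_mul_of_pos_right hτ hpow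
    have hidx : e + 1 + N * e = 1 + (N + 1) * e := by ring
    rw [add_comm 1 (N * e)] at hN hNe
    have hstep := hs N _ hN.coeffLE
    have hdiff := (hstep (e + 1 + N * e)).trans_lt hlt
    rw [coeff_sub] at hdiff
    have hmul := ha.mul hM0 hpow hN.derivative
    have hcoeff := ha.norm_coeff_mul_sub_lt hM0 hpow hN.derivative
    have hlead : ‖a.coeff (e + 1) * (derivative (s N)).coeff (N * e)‖ = M * M ^ N := by
      rw [coeff_derivative, Nat.cast_mul, he, mul_zero, zero_add, mul_one, norm_mul, hM, hNe]
    rw [pow_succ', ← hidx]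
    refine ⟨hmul.of_sub hstep hlt, hlead ▸ norm_eq_of_norm_sub_lt ?_⟩
    rw [hlead, ← sub_add_sub_cancel _ ((a * derivative (s N)).coeff (e + 1 + N * e))]
    exact norm_add_lt_of_norm_lt hdiff hcoeff

/-- If the reduction of `compOp f (qChoose lam m) X` has order `e + 1` with `e = 0` in the residue
field, this operator is close to a vector field all of whose iterates are large, against the decay
of the `λ`-factorials. -/
lemma HasPoincareSeries.norm_coeff_compOp_qChoose_le_one {p : ℕ} [Fact p.Prime] [CharP L p]
    (hP : HasPoincareSeries lam f) (hroot : ∀ n : ℕ, 0 < n → lam ^ n ≠ 1) (hlam : ‖lam - 1‖ < 1)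
    (hδ : CoeffLE ‖lam - 1‖ (f - X)) (hm : 0 < m)
    (hlt : ∀ j < m, CoeffLE 1 (compOp f (qChoose lam j) X)) {e : ℕ} (he : (e : L) = 0)
    (hd : ReducedOrderGE ‖(compOp f (qChoose lam m) X).coeff (e + 1)‖ (e + 1)
      (compOp f (qChoose lam m) X)) :
    ‖(compOp f (qChoose lam m) X).coeff (e + 1)‖ ≤ 1 := by
  let a := compOp f (qChoose lam m) X
  let M := ‖a.coeff (e + 1)‖
  by_contra! hM
  have hτ : max 1 (‖lam - 1‖ * M) < M := max_lt hM (mul_lt_of_lt_one_left (by linarith) hlam)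
  have hf : CoeffLE 1 f := sub_add_cancel f X ▸ (hδ.mono hlam.le).add coeffLE_X
  have hπ : qRising lam 1 m ≠ 0 := qRising_one_ne_zero hroot m
  let s N := (qRising lam 1 m ^ N)⁻¹ • compOp f (qFalling lam 0 (N * m)) X
  have hs : ∀ N B, CoeffLE B (s N) →
      CoeffLE (max 1 (‖lam - 1‖ * M) * B) (s (N + 1) - vectorField a (s N)) := fun N B hB => by
    have hsucc : s (N + 1) = (qRising lam 1 m)⁻¹ • compOp f (qFalling lam (N * m) m) (s N) := by
      simp only [s, add_mul, one_mul, qFalling_add, zero_add, map_smul, smul_smul, pow_succ',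
        mul_inv, ← compOp_mul]
      rw [mul_comm (qFalling lam 0 _)]
    rw [hsucc]
    exact hB.compOp_qFalling_sub_vectorField hroot (norm_eq_one_of_norm_sub_one_lt hlam).le hf hδ hm
      hlt hd.coeffLE _
  refine hP.not_forall_pow_le (p := p) hlam hm X 1 e (norm_pos_iff.2 hπ) fun N => ?_
  have hsN := (reducedOrderGE_pow_of_forall_coeffLE_sub_vectorField he hd rfl hτ
    (by simp [s, qFalling_zero]) hs N).2
  rw [coeff_smul, norm_smul, norm_inv, norm_pow, inv_mul_eq_iff_eq_mul₀ (by positivity)] at hsN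
  rw [hsN]
  exact le_mul_of_one_le_right (by positivity) (one_le_pow₀ hM.le)

theorem HasPoincareSeries.coeffLE_compOp_qChoose {p : ℕ} [Fact p.Prime] [CharP L p]
    (hP : HasPoincareSeries lam f) (hroot : ∀ n : ℕ, 0 < n → lam ^ n ≠ 1) (hlam : ‖lam - 1‖ < 1)
    (hfg : f = X + (lam - 1) • g) (hg : CoeffLE 1 g) (hg0 : g.coeff 0 = 0) (hg1 : g.coeff 1 = 1)
    (m : ℕ) : CoeffLE 1 (compOp f (qChoose lam m) X) := by
  induction m using Nat.strong_induction_on with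
  | _ m hlt =>
  by_contra hbad
  have hm : 0 < m := Nat.pos_of_ne_zero fun h => hbad (by
    rw [h, qChoose_zero, compOp_one]; exact coeffLE_X)
  let a := compOp f (qChoose lam m) X
  obtain ⟨d, hd⟩ := exists_reducedOrderGE a
  let M := ‖a.coeff d‖
  have hM : 1 < M := not_le.1 fun h => hbad (hd.coeffLE.mono h)
  have hf0 : f.eval 0 = 0 := by simp [← coeff_zero_eq_eval_zero, hfg, hg0]
  obtain ⟨e, rfl⟩ : ∃ e, d = e + 1 := Nat.exists_eq_succ_of_ne_zero fun h => by
    have : M = 0 := by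
      simp only [M, a, h, coeff_zero_eq_eval_zero, eval_compOp hf0, eval_X, mul_zero, norm_zero]
    linarith
  have he : (e : L) = 0 := by
    have h := hd.norm_natCast_mul_coeff_lt hg hg0 hg1 (by linarith)
      (coeffLE_commutator_vectorField hroot hlam hfg hg hm hlt hd.coeffLE)
      (max_lt hM (mul_lt_of_lt_one_left (by linarith) hlam))
    by_contra hne
    rw [norm_mul, norm_natCast_eq_one (mt (CharP.cast_eq_zero_iff L p e).2 hne), one_mul] at h
    exact lt_irrefl _ h
  have hδ : CoeffLE ‖lam - 1‖ (f - X) := by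
    simpa only [hfg, add_sub_cancel_left, mul_one] using hg.smul (lam - 1)
  exact hM.not_ge (hP.norm_coeff_compOp_qChoose_le_one hroot hlam hδ hm hlt he hd)

end Integrality

section FixedPoints

variable {L : Type*} [NormedField L] {f g : L[X]} {lam x : L} {m : ℕ}

lemma exists_root_norm_sub_lt_one [IsAlgClosed L] {q : L[X]} (hq : q.Monic)
    (hx : ‖q.eval x‖ < 1) : ∃ t, q.eval t = 0 ∧ ‖x - t‖ < 1 := by
  have hprod (s : Multiset L) (hs : ∀ t ∈ s, 1 ≤ ‖x - t‖) :
      1 ≤ ‖(s.map fun t => x - t).prod‖ := by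
    induction s using Multiset.induction_on with
    | empty => simp
    | cons a s ih =>
      rw [Multiset.map_cons, Multiset.prod_cons, norm_mul]
      exact one_le_mul_of_one_le_of_one_le (hs a (Multiset.mem_cons_self a s))
        (ih fun t ht => hs t (Multiset.mem_cons_of_mem ht))
  by_contra! h
  rw [(IsAlgClosed.splits q).eval_eq_prod_roots_of_monic hq x] at hx
  exact (hprod _ fun t ht => h t (isRoot_of_mem_roots ht)).not_gt hx

variable [IsUltrametricDist L]

lemma norm_qRising_one_add_le (hlam : ‖lam‖ ≤ 1) (a b : ℕ) :
    ‖qRising lam 1 (a + b)‖ ≤ ‖qRising lam 1 a‖ * ‖qRising lam 1 b‖ := by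
  rw [qRising_add, norm_mul]
  exact mul_le_mul_of_nonneg_left (norm_qRising_le hlam _ _) (norm_nonneg _)

/-- If `λⁱ` is the power closest to `x`, then `‖x - λʲ‖ ≥ ‖λʲ - λⁱ‖` for `j ≠ i`. -/
lemma norm_qRising_mul_le_of_forall_norm_sub_le (hlam : ‖lam‖ = 1) {i k : ℕ}
    (hmin : ∀ j < i + (k + 1), ‖x - lam ^ i‖ ≤ ‖x - lam ^ j‖) :
    ‖qRising lam 1 i‖ * ‖qRising lam 1 k‖ * ‖x - lam ^ i‖
      ≤ ‖(qFalling lam 0 (i + (k + 1))).eval x‖ := by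
  have hdist : ∀ j < i + (k + 1), ‖lam ^ j - lam ^ i‖ ≤ ‖x - lam ^ j‖ := fun j hj => by
    rw [← sub_sub_sub_cancel_left _ _ x]
    exact norm_sub_le_of_norm_le (hmin j hj) le_rfl
  have hbelow : ‖qRising lam 1 i‖ ≤ ‖∏ j ∈ range i, (x - lam ^ j)‖ := by
    rw [qRising, norm_prod, norm_prod, ← prod_range_reflect]
    refine prod_le_prod (fun _ _ => norm_nonneg _) fun j hj => ?_
    have hj := mem_range.1 hj
    have hfactor : lam ^ j - lam ^ i = -(lam ^ j * (lam ^ (1 + (i - 1 - j)) - 1)) := by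
      rw [mul_sub, ← pow_add, show j + (1 + (i - 1 - j)) = i by omega]; ring
    refine (le_of_eq ?_).trans (hdist j (by omega))
    rw [hfactor, norm_neg, norm_mul, norm_pow, hlam, one_pow, one_mul]
  have habove : ‖qRising lam 1 k‖ ≤ ‖∏ j ∈ range k, (x - lam ^ (i + (j + 1)))‖ := by
    rw [qRising, norm_prod, norm_prod]
    refine prod_le_prod (fun _ _ => norm_nonneg _) fun j hj => ?_
    have hj := mem_range.1 hj
    have hfactor : lam ^ (i + (j + 1)) - lam ^ i = lam ^ i * (lam ^ (1 + j) - 1) := by ring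
    refine (le_of_eq ?_).trans (hdist _ (by omega))
    rw [hfactor, norm_mul, norm_pow, hlam, one_pow, one_mul]
  have hsplit : (qFalling lam 0 (i + (k + 1))).eval x = (∏ j ∈ range i, (x - lam ^ j))
      * ((∏ j ∈ range k, (x - lam ^ (i + (j + 1)))) * (x - lam ^ i)) := by
    simp only [qFalling, eval_mul, eval_prod, eval_sub, eval_X, eval_C, zero_add, prod_range_add,
      prod_range_succ', add_zero]
  rw [hsplit, norm_mul, norm_mul, mul_assoc]
  gcongr

lemma exists_norm_sub_pow_le (hroot : ∀ n : ℕ, 0 < n → lam ^ n ≠ 1) (hlam : ‖lam‖ = 1)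
    (hm : 0 < m) (h : ‖(qFalling lam 0 m).eval x‖ ≤ ‖qRising lam 1 m‖) :
    ∃ i < m, ‖x - lam ^ i‖ ≤ ‖lam ^ m - 1‖ := by
  obtain ⟨i, hi, hmin⟩ := exists_min_image (range m) (fun i => ‖x - lam ^ i‖)
    ⟨0, mem_range.2 hm⟩
  refine ⟨i, mem_range.1 hi, ?_⟩
  obtain ⟨k, rfl⟩ := Nat.exists_eq_add_of_lt (mem_range.1 hi)
  have hpos : 0 < ‖qRising lam 1 i‖ * ‖qRising lam 1 k‖ :=
    mul_pos (norm_pos_iff.2 (qRising_one_ne_zero hroot i))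
      (norm_pos_iff.2 (qRising_one_ne_zero hroot k))
  refine le_of_mul_le_mul_left ?_ hpos
  calc _ ≤ ‖(qFalling lam 0 (i + (k + 1))).eval x‖ :=
        norm_qRising_mul_le_of_forall_norm_sub_le hlam fun j hj => hmin j (mem_range.2 hj)
    _ ≤ ‖qRising lam 1 (i + k)‖ * ‖lam ^ (i + k + 1) - 1‖ := by
        refine h.trans_eq ?_
        rw [qRising_succ, norm_mul, add_comm 1 (i + k)]
    _ ≤ _ := mul_le_mul_of_nonneg_right (norm_qRising_one_add_le hlam.le i k) (norm_nonneg _)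

lemma HasPoincareSeries.exists_norm_multiplier_sub_pow_lt {p : ℕ} [Fact p.Prime] [CharP L p]
    (hP : HasPoincareSeries lam f) (hroot : ∀ n : ℕ, 0 < n → lam ^ n ≠ 1) (hlam : ‖lam - 1‖ < 1)
    (hfg : f = X + (lam - 1) • g) (hg : CoeffLE 1 g) (hg0 : g.coeff 0 = 0) (hg1 : g.coeff 1 = 1)
    (hx1 : ‖x‖ ≤ 1) (hx : g.eval x = 0) {ε : ℝ} (hε : 0 < ε) :
    ∃ i, ‖(derivative f).eval x - lam ^ (i + 1)‖ < ε := by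
  have hprime : p.Prime := Fact.out
  have hlam1 := norm_eq_one_of_norm_sub_one_lt hlam
  obtain ⟨N, hN⟩ := exists_pow_lt_of_lt_one hε hlam
  have hm : ‖lam ^ p ^ N - 1‖ < ε := by
    rw [pow_prime_pow_sub_one, norm_pow]
    exact (pow_le_pow_of_le_one (norm_nonneg _) hlam.le (Nat.lt_pow_self hprime.one_lt).le).trans_lt
      hN
  obtain ⟨k, hk⟩ := Nat.exists_eq_add_one_of_ne_zero (pow_pos hprime.pos N).ne'
  have hfx : f.eval x = x := by rw [hfg, eval_add, eval_X, eval_smul, hx, smul_zero, add_zero]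
  have h := (hP.coeffLE_compOp_qChoose (p := p) hroot hlam hfg hg hg0 hg1
    (p ^ N)).derivative.norm_eval_le hx1
  rw [eval_derivative_compOp hfx, derivative_X, eval_one, mul_one, qChoose, eval_C_mul, norm_mul,
    norm_inv, inv_mul_le_one₀ (norm_pos_iff.2 (qRising_one_ne_zero hroot _))] at h
  obtain ⟨i, -, hi⟩ := exists_norm_sub_pow_le hroot hlam1 (pow_pos hprime.pos N) h
  refine ⟨i + k, ?_⟩
  rw [add_assoc, ← hk, ← sub_add_sub_cancel _ (lam ^ i), pow_add, ← mul_one_sub]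
  refine norm_add_lt_of_norm_lt (hi.trans_lt hm) ?_
  rwa [norm_mul, norm_pow, hlam1, one_pow, one_mul, norm_sub_rev]

end FixedPoints

section Trinomial

/-- The trinomial `λ X + b X² + a Xᵖ`. -/
noncomputable def trinomial {R : Type*} [Semiring R] (p : ℕ) (lam b a : R) : R[X] :=
  C lam * X + C b * X ^ 2 + C a * X ^ p

variable {L : Type*} [NormedField L] {p : ℕ} {lam : L}

lemma HasPoincareSeries.trinomial_scale (hp : 0 < p) {b a ρ : L}
    (h : HasPoincareSeries lam (trinomial p lam b a)) (hρ : ρ ≠ 0) :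
    HasPoincareSeries lam (trinomial p lam (b * ρ) (a * ρ ^ (p - 1))) := by
  convert h.scale hρ using 1
  obtain ⟨k, rfl⟩ := Nat.exists_eq_add_of_lt hp
  have hC : C ρ⁻¹ * C ρ = 1 := by rw [← C_mul, inv_mul_cancel₀ hρ, C_1]
  simp only [trinomial, add_comp, mul_comp, C_comp, X_comp, X_pow_comp, C_mul, C_pow,
    Nat.add_sub_cancel, zero_add]
  linear_combination
    -(C lam * X + C b * C ρ * X ^ 2 + C a * C ρ ^ k * X ^ (k + 1)) * hC

variable [Fact p.Prime] [CharP L p]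

lemma norm_two_eq_one (hp : 2 < p) : ‖(2 : L)‖ = 1 := by
  exact_mod_cast norm_natCast_eq_one (p := p) (L := L) (n := 2)
    (Nat.not_dvd_of_pos_of_lt two_pos hp)

variable [IsUltrametricDist L]

lemma HasPoincareSeries.exists_norm_trinomial_multiplier_sub_pow_lt {b a x : L}
    (hP : HasPoincareSeries lam (trinomial p lam ((lam - 1) * b) ((lam - 1) * a))) (hp : 2 < p)
    (hroot : ∀ n : ℕ, 0 < n → lam ^ n ≠ 1) (hlam : ‖lam - 1‖ < 1) (hb : ‖b‖ ≤ 1) (ha : ‖a‖ ≤ 1)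
    (hx1 : ‖x‖ ≤ 1) (hx : 1 + b * x + a * x ^ (p - 1) = 0) {ε : ℝ} (hε : 0 < ε) :
    ∃ i, ‖lam + 2 * ((lam - 1) * b * x) - lam ^ (i + 1)‖ < ε := by
  let g : L[X] := trinomial p 1 b a
  have hfg : trinomial p lam ((lam - 1) * b) ((lam - 1) * a) = X + (lam - 1) • g := by
    simp only [g, trinomial, smul_eq_C_mul, C_mul, C_sub, C_1]
    ring
  have hmonomial : ∀ (c : L) (n : ℕ), ‖c‖ ≤ 1 → CoeffLE 1 (C c * X ^ n) := fun c n hc => by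
    rw [← smul_eq_C_mul]
    exact ((coeffLE_X_pow n).smul c).mono (by rwa [mul_one])
  have hg : CoeffLE 1 g := by
    refine (CoeffLE.add ?_ (hmonomial b 2 hb)).add (hmonomial a p ha)
    rw [C_1, one_mul]
    exact coeffLE_X
  have hg0 : g.coeff 0 = 0 := by simp [g, trinomial, coeff_X_pow, show (0 : ℕ) ≠ p by omega]
  have hg1 : g.coeff 1 = 1 := by simp [g, trinomial, coeff_X_pow, show (1 : ℕ) ≠ p by omega]
  have hgx : g.eval x = 0 := by
    obtain ⟨k, rfl⟩ : ∃ k, p = k + 1 := ⟨p - 1, by omega⟩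
    rw [Nat.add_sub_cancel] at hx
    simp only [g, trinomial, eval_add, eval_mul, eval_X, eval_C, eval_pow]
    linear_combination x * hx
  have hder : (derivative (trinomial p lam ((lam - 1) * b) ((lam - 1) * a))).eval x
      = lam + 2 * ((lam - 1) * b * x) := by
    simp [trinomial, derivative_X_pow]
    ring
  exact hder ▸ hP.exists_norm_multiplier_sub_pow_lt (p := p) hroot hlam hfg hg hg0 hg1 hx1 hgx hε

lemma exists_norm_one_add_eq [IsAlgClosed L] (hp : 3 ≤ p) (hodd : Odd p) {b : L} (hb : ‖b‖ < 1) :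
    ∃ x : L, ‖x‖ = 1 ∧ 1 + x + b * x ^ (p - 1) = 0 := by
  obtain ⟨k, rfl⟩ : ∃ k, p = 2 * k + 3 := by
    obtain ⟨r, hr⟩ := hodd; exact ⟨r - 1, by omega⟩
  have hmonic : (X ^ (2 * k + 2) + (X ^ (2 * k + 1) + C b) : L[X]).Monic := by
    refine monic_X_pow_add ((degree_add_le _ _).trans_lt (max_lt ?_ ?_))
    · rw [degree_X_pow]; exact_mod_cast Nat.lt_succ_self _
    · exact degree_C_le.trans_lt (by exact_mod_cast Nat.succ_pos _)
  have heval : (X ^ (2 * k + 2) + (X ^ (2 * k + 1) + C b) : L[X]).eval (-1) = b := by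
    simp [pow_add, pow_mul]
  obtain ⟨t, ht, htn⟩ := exists_root_norm_sub_lt_one hmonic (x := -1) (by rwa [heval])
  have ht1 : ‖t‖ = 1 := by
    rw [norm_eq_of_norm_sub_lt (y := -1) (by rwa [norm_sub_rev, norm_neg, norm_one]), norm_neg,
      norm_one]
  have ht0 : t ≠ 0 := norm_ne_zero_iff.1 (by rw [ht1]; exact one_ne_zero)
  refine ⟨t⁻¹, by rw [norm_inv, ht1, inv_one], ?_⟩
  simp only [eval_add, eval_pow, eval_X, eval_C] at ht
  have h : 2 * k + 3 - 1 = 2 * k + 2 := by omega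
  have hinv (n : ℕ) : t ^ n * t⁻¹ ^ n = 1 := by rw [← mul_pow, mul_inv_cancel₀ ht0, one_pow]
  rw [h]
  linear_combination t⁻¹ ^ (2 * k + 2) * ht - hinv (2 * k + 2) - t⁻¹ * hinv (2 * k + 1)

/-- The fixed point close to `-1` has a multiplier `μ` with `‖λμ - 1‖ = ‖λ - 1‖ ^ 2`, a norm which
no power of `λ` attains. -/
lemma not_hasPoincareSeries_of_norm_lt [IsAlgClosed L] (hp : 2 < p)
    (hroot : ∀ n : ℕ, 0 < n → lam ^ n ≠ 1) (hlam : ‖lam - 1‖ < 1) {b : L}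
    (hb : ‖b‖ < ‖lam - 1‖) :
    ¬ HasPoincareSeries lam (trinomial p lam (lam - 1) ((lam - 1) * b)) := by
  intro hP
  have hE : 0 < ‖lam - 1‖ := (norm_nonneg b).trans_lt hb
  have hlam1 := norm_eq_one_of_norm_sub_one_lt hlam
  have hodd : Odd p := (Fact.out : p.Prime).odd_of_ne_two (by omega)
  obtain ⟨x, hx1, hx⟩ := exists_norm_one_add_eq hp hodd (hb.trans hlam)
  have hxb : ‖1 + x‖ = ‖b‖ := by
    rw [eq_neg_of_add_eq_zero_left hx, norm_neg, norm_mul, norm_pow, hx1, one_pow, mul_one]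
  obtain ⟨i, hi⟩ := HasPoincareSeries.exists_norm_trinomial_multiplier_sub_pow_lt (b := 1)
    (by rwa [mul_one]) hp hroot hlam norm_one.le (hb.trans hlam).le hx1.le (by rwa [one_mul])
    (pow_pos hE 2)
  have hpow : ‖lam ^ (i + 2) - 1‖ = ‖lam - 1‖ ^ 2 := by
    rw [← norm_pow, ← norm_neg (_ ^ 2)]
    refine norm_eq_of_norm_sub_lt ?_
    have hexpand : lam ^ (i + 2) - 1 - -(lam - 1) ^ 2
        = 2 * lam * ((lam - 1) * (1 + x))
          - lam * (lam + 2 * ((lam - 1) * 1 * x) - lam ^ (i + 1)) := by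
      ring
    rw [norm_neg, norm_pow, hexpand]
    refine norm_sub_lt_of_norm_lt ?_ (by rwa [norm_mul, hlam1, one_mul])
    rw [norm_mul, norm_mul, norm_mul, norm_two_eq_one hp, hlam1, hxb, one_mul, one_mul, sq]
    exact mul_lt_mul_of_pos_left hb hE
  have hgap := norm_pow_sub_one_le_pow_prime (p := p) (a := 1) (b := i + 2) hlam one_ne_zero (by
    rw [pow_one, hpow]
    exact pow_lt_self_of_lt_one₀ hE hlam one_lt_two)
  rw [pow_one, hpow] at hgap
  exact hgap.not_gt (pow_lt_pow_right_of_lt_one₀ hE hlam hp)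

end Trinomial

section Resonant

variable {L : Type*} [NormedField L]

lemma degree_C_mul_X_add_one_lt {n : ℕ} (hn : 1 < n) (η : L) : (C η * X + 1 : L[X]).degree < n :=
  (degree_linear_le (a := η) (b := 1)).trans_lt (by exact_mod_cast hn)

lemma natDegree_X_pow_sub_linear {n : ℕ} (hn : 1 < n) (η : L) :
    (X ^ n - (C η * X + 1) : L[X]).natDegree = n :=
  natDegree_eq_of_degree_eq_some (degree_sub_eq_left_of_degree_lt
    ((degree_C_mul_X_add_one_lt hn η).trans_eq (degree_X_pow n).symm) |>.trans (degree_X_pow n))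

lemma sum_roots_X_pow_sub_linear [IsAlgClosed L] {n : ℕ} (hn : 2 < n) (η : L) :
    (X ^ n - (C η * X + 1) : L[X]).roots.sum = 0 := by
  have hmonic := monic_X_pow_sub (degree_C_mul_X_add_one_lt (by omega : 1 < n) η)
  have hdeg := natDegree_X_pow_sub_linear (by omega : 1 < n) η
  rw [← neg_eq_zero, ← (IsAlgClosed.splits _).nextCoeff_eq_neg_sum_roots_of_monic hmonic,
    nextCoeff_of_natDegree_pos (by omega), hdeg]
  simp [coeff_X_pow, coeff_X, coeff_one, show n - 1 ≠ n by omega, show 1 ≠ n - 1 by omega,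
    show n - 1 ≠ 0 by omega]

variable [IsUltrametricDist L]

lemma norm_eq_one_of_pow_eq {n : ℕ} (hn : 1 < n) {η x : L} (hη : ‖η‖ ≤ 1)
    (hx : x ^ n = 1 + η * x) : ‖x‖ = 1 := by
  have hηx : ‖η * x‖ ≤ ‖x‖ := by
    rw [norm_mul]
    exact mul_le_of_le_one_left (norm_nonneg _) hη
  refine le_antisymm ?_ ?_ <;> by_contra! h
  · have hle : ‖x ^ n‖ ≤ ‖x‖ := hx ▸ norm_add_le_of_norm_le (norm_one.trans_le h.le) hηx
    rw [norm_pow] at hle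
    exact hle.not_gt (lt_self_pow₀ h hn)
  · have hlt : ‖x ^ n - η * x‖ < 1 := by
      refine norm_sub_lt_of_norm_lt ?_ (hηx.trans_lt h)
      rw [norm_pow]
      exact pow_lt_one₀ (norm_nonneg _) h (by omega)
    rw [hx, add_sub_cancel_right, norm_one] at hlt
    exact hlt.false

/-- The roots near `1` and `-1`; the lower bound on their sum comes from
`x₁ⁿ - (-x₂)ⁿ = η * (x₁ - x₂)`. -/
lemma exists_roots_X_pow_sub_linear [IsAlgClosed L] {n : ℕ} (hn : 1 < n) (he : Even n)
    (h2 : ‖(2 : L)‖ = 1) {η : L} (hη : ‖η‖ < 1) :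
    ∃ x y : L, x ^ n = 1 + η * x ∧ y ^ n = 1 + η * y ∧ ‖x + y‖ < 1 ∧ ‖η‖ ≤ ‖x + y‖ := by
  have hmonic := monic_X_pow_sub (degree_C_mul_X_add_one_lt hn η)
  obtain ⟨x, hx, hx1⟩ := exists_root_norm_sub_lt_one hmonic (x := 1) (by simpa using hη)
  obtain ⟨y, hy, hy1⟩ := exists_root_norm_sub_lt_one hmonic (x := -1)
    (by simpa [he.neg_one_pow] using hη)
  simp only [eval_sub, eval_add, eval_pow, eval_X, eval_mul, eval_C, eval_one] at hx hy
  have hadd : ‖x + y‖ < 1 := by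
    rw [show x + y = -((1 - x) + (-1 - y)) by ring, norm_neg]
    exact norm_add_lt_of_norm_lt hx1 hy1
  refine ⟨x, y, by linear_combination hx, by linear_combination hy, hadd, ?_⟩
  have hxn : ‖x‖ = 1 := norm_eq_one_of_norm_sub_one_lt (by rwa [norm_sub_rev])
  have hyn : ‖-y‖ = 1 :=
    norm_eq_one_of_norm_sub_one_lt (by rwa [sub_eq_add_neg, add_comm, ← sub_eq_add_neg])
  have hsub : ‖x - y‖ = 1 := by
    have h2y : ‖2 * -y‖ = 1 := by rw [norm_mul, h2, hyn, one_mul]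
    rw [← h2y]
    refine norm_eq_of_norm_sub_lt ?_
    rwa [h2y, show x - y - 2 * -y = x + y by ring]
  calc ‖η‖ = ‖x ^ n - (-y) ^ n‖ := by
        rw [he.neg_pow, show x ^ n - y ^ n = η * (x - y) by linear_combination hx - hy, norm_mul,
          hsub, mul_one]
    _ ≤ ‖x - -y‖ := norm_pow_sub_pow_le hxn.le hyn.le n
    _ = ‖x + y‖ := by rw [sub_neg_eq_add]

variable {lam : L}

lemma norm_sq_mul_pow_add_sub_one_sub_le {u v : L} {δ : ℝ} (hlam : ‖lam‖ ≤ 1) (hδ : δ ≤ 1)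
    (hu : ‖u‖ ≤ δ) (hv : ‖v‖ ≤ δ) {a b : ℕ} (ha : ‖lam + u - lam ^ (a + 1)‖ ≤ δ ^ 2)
    (hb : ‖lam + v - lam ^ (b + 1)‖ ≤ δ ^ 2) :
    ‖lam ^ 2 * (lam ^ (a + b) - 1) - lam * (u + v)‖ ≤ δ ^ 2 := by
  rw [show lam ^ 2 * (lam ^ (a + b) - 1) - lam * (u + v) = u * v
    - (lam + u - lam ^ (a + 1)) * (lam + v) - lam ^ (a + 1) * (lam + v - lam ^ (b + 1)) by ring]
  refine norm_sub_le_of_norm_le (norm_sub_le_of_norm_le ?_ ?_) ?_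
  · rw [norm_mul, sq]
    exact mul_le_mul hu hv (norm_nonneg _) ((norm_nonneg _).trans hu)
  · rw [norm_mul]
    exact (mul_le_of_le_one_right (norm_nonneg _)
      (norm_add_le_of_norm_le hlam (hv.trans hδ))).trans ha
  · rw [norm_mul, norm_pow]
    exact (mul_le_of_le_one_left (norm_nonneg _) (pow_le_one₀ (norm_nonneg _) hlam)).trans hb

lemma norm_pow_sub_one_sub_natCast_mul_le (hlam : ‖lam‖ ≤ 1) (i : ℕ) :
    ‖lam ^ i - 1 - i * (lam - 1)‖ ≤ ‖lam - 1‖ ^ 2 := by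
  have hsum : lam ^ i - 1 - i * (lam - 1) = ∑ j ∈ range i, (lam ^ j - 1) * (lam - 1) := by
    rw [← sum_mul, sum_sub_distrib, sub_mul, geom_sum_mul, sum_const, card_range, nsmul_one]
  rw [hsum]
  refine IsUltrametricDist.norm_sum_le_of_forall_le_of_nonneg (sq_nonneg _) fun j _ => ?_
  rw [norm_mul, sq]
  exact mul_le_mul_of_nonneg_right (norm_pow_sub_one_le hlam j) (norm_nonneg _)

lemma norm_multiset_sum_sub_card_mul_lt {s : Multiset L} {y : L} {B : ℝ} (hB : 0 < B)
    (h : ∀ x ∈ s, ‖x - y‖ < B) : ‖s.sum - s.card * y‖ < B := by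
  have hsum : s.sum - s.card * y = (s.map (· - y)).sum := by
    rw [Multiset.sum_map_sub, Multiset.map_id', Multiset.map_const', Multiset.sum_replicate,
      nsmul_eq_mul]
  rw [hsum]
  refine Multiset.sum_induction (‖·‖ < B) _ (fun _ _ => norm_add_lt_of_norm_lt)
    (by rwa [norm_zero]) fun z hz => ?_
  obtain ⟨x, hx, rfl⟩ := Multiset.mem_map.1 hz
  exact h x hx

variable {p : ℕ} [Fact p.Prime] [CharP L p]

/-- Otherwise `‖λᵃ⁺ᵇ - 1‖` would lie strictly between `‖λᵃ - 1‖ ^ 2` and `‖λᵃ - 1‖`. -/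
lemma norm_add_le_sq_of_norm_sub_pow_lt (hp : 2 < p) (hlam : ‖lam - 1‖ < 1) {u v : L} {δ : ℝ}
    (hδ0 : 0 < δ) (hδ1 : δ < 1) (hu : ‖u‖ = δ) (hv : ‖v‖ = δ) (huv : ‖u + v‖ < δ) {a b : ℕ}
    (ha : ‖lam + u - lam ^ (a + 1)‖ < δ ^ 2) (hb : ‖lam + v - lam ^ (b + 1)‖ < δ ^ 2) :
    ‖u + v‖ ≤ δ ^ 2 := by
  have hlam1 := norm_eq_one_of_norm_sub_one_lt hlam
  by_contra! hgt
  have hpow_a : ‖lam ^ a - 1‖ = δ := by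
    rw [← one_mul ‖_ - _‖, ← hlam1, ← norm_mul, ← hu]
    refine norm_eq_of_norm_sub_lt ?_
    rw [hu, norm_sub_rev, show u - lam * (lam ^ a - 1) = lam + u - lam ^ (a + 1) by ring]
    exact ha.trans (pow_lt_self_of_lt_one₀ hδ0 hδ1 one_lt_two)
  have hpow_ab : ‖lam ^ (a + b) - 1‖ = ‖u + v‖ := by
    have h := norm_sq_mul_pow_add_sub_one_sub_le hlam1.le hδ1.le hu.le hv.le ha.le hb.le
    have huv' : ‖lam * (u + v)‖ = ‖u + v‖ := by rw [norm_mul, hlam1, one_mul]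
    rw [← huv', ← norm_eq_of_norm_sub_lt (h.trans_lt (hgt.trans_eq huv'.symm)), norm_mul, norm_pow,
      hlam1, one_pow, one_mul]
  have ha0 : a ≠ 0 := by
    rintro rfl
    rw [pow_zero, sub_self, norm_zero] at hpow_a
    exact hδ0.ne hpow_a
  have hgap := norm_pow_sub_one_le_pow_prime (p := p) hlam ha0 (hpow_ab.trans_lt (huv.trans_eq
    hpow_a.symm))
  rw [hpow_a, hpow_ab] at hgap
  exact (hgap.trans_lt (pow_lt_pow_right_of_lt_one₀ hδ0 hδ1 hp)).not_gt hgt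

/-- The fixed points near `1` and `-1` have incompatible multipliers. -/
lemma not_hasPoincareSeries_resonant_of_norm_lt_one [IsAlgClosed L] (hp : 2 < p)
    (hroot : ∀ n : ℕ, 0 < n → lam ^ n ≠ 1) (hlam : ‖lam - 1‖ < 1) {η : L} (hη0 : η ≠ 0)
    (hη : ‖η‖ < 1) :
    ¬ HasPoincareSeries lam (trinomial p lam ((lam - 1) * η) ((lam - 1) * -1)) := by
  intro hP
  have h2 : ‖(2 : L)‖ = 1 := norm_two_eq_one hp
  obtain ⟨x, y, hx, hy, hlt, hle⟩ := exists_roots_X_pow_sub_linear (show 1 < p - 1 by omega)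
    ((Fact.out : p.Prime).even_sub_one (by omega)) h2 hη
  set ζ := (lam - 1) * η with hζ
  have hζ0 : 0 < ‖ζ‖ := norm_pos_iff.2 (mul_ne_zero (sub_ne_zero.2 (by simpa using hroot 1)) hη0)
  have hζη : ‖ζ‖ < ‖η‖ := by
    rw [hζ, norm_mul]
    exact mul_lt_of_lt_one_left (norm_pos_iff.2 hη0) hlam
  have hmultiplier {z : L} (hz : z ^ (p - 1) = 1 + η * z) :
      ‖2 * (ζ * z)‖ = ‖ζ‖ ∧ ∃ a, ‖lam + 2 * (ζ * z) - lam ^ (a + 1)‖ < ‖ζ‖ ^ 2 := by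
    have hz1 := norm_eq_one_of_pow_eq (show 1 < p - 1 by omega) hη.le hz
    refine ⟨by rw [norm_mul, norm_mul, h2, hz1, one_mul, mul_one], ?_⟩
    exact hP.exists_norm_trinomial_multiplier_sub_pow_lt hp hroot hlam hη.le
      (by rw [norm_neg, norm_one]) hz1.le (by linear_combination -hz) (pow_pos hζ0 2)
  obtain ⟨hxζ, a, ha⟩ := hmultiplier hx
  obtain ⟨hyζ, b, hb⟩ := hmultiplier hy
  have hadd : ‖2 * (ζ * x) + 2 * (ζ * y)‖ = ‖ζ‖ * ‖x + y‖ := by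
    rw [← mul_add, ← mul_add, norm_mul, norm_mul, h2, one_mul]
  have hsq := norm_add_le_sq_of_norm_sub_pow_lt hp hlam hζ0 (hζη.trans hη) hxζ hyζ
    (hadd.trans_lt (mul_lt_of_lt_one_right hζ0 hlt)) ha hb
  rw [hadd, sq] at hsq
  exact hsq.not_gt (mul_lt_mul_of_pos_left (hζη.trans_le hle) hζ0)

/-- In the residue field, `2bx` lies in the prime field. -/
lemma HasPoincareSeries.norm_pow_prime_sub_self_lt_one {b a x : L}
    (hP : HasPoincareSeries lam (trinomial p lam ((lam - 1) * b) ((lam - 1) * a))) (hp : 2 < p)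
    (hroot : ∀ n : ℕ, 0 < n → lam ^ n ≠ 1) (hlam : ‖lam - 1‖ < 1) (hb : ‖b‖ ≤ 1) (ha : ‖a‖ ≤ 1)
    (hx1 : ‖x‖ ≤ 1) (hx : 1 + b * x + a * x ^ (p - 1) = 0) : ‖(b * x) ^ p - b * x‖ < 1 := by
  have hE : 0 < ‖lam - 1‖ := norm_pos_iff.2 (sub_ne_zero.2 (by simpa using hroot 1))
  have hnat (n : ℕ) : (n : L) ^ p = n := map_natCast (frobenius L p) n
  obtain ⟨i, hi⟩ := hP.exists_norm_trinomial_multiplier_sub_pow_lt hp hroot hlam hb ha hx1 hx hE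
  have hcong : ‖2 * (b * x) - i‖ < 1 := by
    have h := norm_add_lt_of_norm_lt hi
      ((norm_pow_sub_one_sub_natCast_mul_le (norm_eq_one_of_norm_sub_one_lt hlam).le
        (i + 1)).trans_lt (pow_lt_self_of_lt_one₀ hE hlam one_lt_two))
    rw [show lam + 2 * ((lam - 1) * b * x) - lam ^ (i + 1)
        + (lam ^ (i + 1) - 1 - (i + 1 : ℕ) * (lam - 1)) = (lam - 1) * (2 * (b * x) - i) by
      push_cast; ring, norm_mul] at h
    exact lt_of_mul_lt_mul_left (h.trans_eq (mul_one _).symm) hE.le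
  have hfrob : 2 * ((b * x) ^ p - b * x) = (2 * (b * x) - i) ^ p - (2 * (b * x) - i) := by
    have h2 := hnat 2
    push_cast at h2
    rw [sub_pow_char, mul_pow 2, hnat, h2]
    ring
  have h : ‖(2 * (b * x) - i) ^ p - (2 * (b * x) - i)‖ < 1 := by
    refine norm_sub_lt_of_norm_lt ?_ hcong
    rw [norm_pow]
    exact pow_lt_one₀ (norm_nonneg _) hcong (by omega)
  rwa [← hfrob, norm_mul, norm_two_eq_one hp, one_mul] at h

/-- All nonzero fixed points are congruent modulo the maximal ideal, but they sum to zero. -/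
lemma not_hasPoincareSeries_resonant_of_norm_eq_one [IsAlgClosed L] (hp : 3 < p)
    (hroot : ∀ n : ℕ, 0 < n → lam ^ n ≠ 1) (hlam : ‖lam - 1‖ < 1) {η : L} (hη : ‖η‖ = 1) :
    ¬ HasPoincareSeries lam (trinomial p lam ((lam - 1) * η) ((lam - 1) * -1)) := by
  intro hP
  let q : L[X] := X ^ (p - 1) - (C η * X + 1)
  have hroots : ∀ x ∈ q.roots, x ^ (p - 1) = 1 + η * x := fun x hx => by
    have h := isRoot_of_mem_roots hx
    simp only [q, IsRoot, eval_sub, eval_add, eval_pow, eval_X, eval_mul, eval_C, eval_one] at h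
    linear_combination h
  have hnorm : ∀ x ∈ q.roots, ‖x‖ = 1 := fun x hx =>
    norm_eq_one_of_pow_eq (show 1 < p - 1 by omega) hη.le (hroots x hx)
  have hkey : ∀ x ∈ q.roots, ‖η ^ (p - 1) * (1 + η * x) - 1‖ < 1 := fun x hx => by
    have h := hP.norm_pow_prime_sub_self_lt_one (by omega) hroot hlam hη.le
      (by rw [norm_neg, norm_one]) (hnorm x hx).le (by linear_combination -hroots x hx)
    have hfactor : (η * x) ^ p - η * x = η * x * (η ^ (p - 1) * (1 + η * x) - 1) := by
      rw [← hroots x hx, ← mul_pow, mul_sub, ← pow_succ', Nat.sub_add_cancel (by omega), mul_one]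
    rwa [hfactor, norm_mul, norm_mul, hη, hnorm x hx, one_mul, one_mul] at h
  have hcard : q.roots.card = p - 1 := by
    rw [← (IsAlgClosed.splits q).natDegree_eq_card_roots]
    exact natDegree_X_pow_sub_linear (by omega) η
  obtain ⟨y, hy⟩ : ∃ y, y ∈ q.roots :=
    Multiset.card_pos_iff_exists_mem.1 (by rw [hcard]; omega)
  have hcong : ∀ x ∈ q.roots, ‖x - y‖ < 1 := fun x hx => by
    have h := norm_sub_lt_of_norm_lt (hkey x hx) (hkey y hy)
    rwa [show η ^ (p - 1) * (1 + η * x) - 1 - (η ^ (p - 1) * (1 + η * y) - 1)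
      = η ^ (p - 1) * η * (x - y) by ring, norm_mul, norm_mul, norm_pow, hη, one_pow, one_mul,
      one_mul] at h
  have h := norm_multiset_sum_sub_card_mul_lt one_pos hcong
  rw [sum_roots_X_pow_sub_linear (by omega), hcard, zero_sub, norm_neg, norm_mul, hnorm y hy,
    mul_one, norm_natCast_eq_one (p := p) (Nat.not_dvd_of_pos_of_lt (by omega) (by omega))] at h
  exact h.false

end Resonant

section Balanced

lemma vectorField_mul_of_derivative_eq_zero {R : Type*} [CommRing R] {a F : R[X]}
    (hF : derivative F = 0) (G : R[X]) : vectorField a (F * G) = F * vectorField a G := by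
  rw [vectorField_apply, vectorField_apply, derivative_mul, hF, zero_mul, zero_add, mul_left_comm]

section CharP

variable {L : Type*} [Field L] {p : ℕ} [CharP L p]

lemma derivative_neg_X_pow_char_pow (n : ℕ) : derivative ((-X ^ p) ^ n : L[X]) = 0 := by
  rw [derivative_pow, derivative_neg, derivative_X_pow, CharP.cast_eq_zero L p, C_0, zero_mul,
    neg_zero, mul_zero]

lemma vectorField_pow_half {k : ℕ} (hk : p = 2 * k + 1) :
    vectorField (X ^ 2 + X ^ p) ((X ^ 2 + X ^ p) ^ k : L[X]) = -X * (X ^ 2 + X ^ p) ^ k := by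
  have h2k : (k * 2 : L[X]) = -1 := by
    have h : ((2 * k + 1 : ℕ) : L[X]) = 0 := by rw [← hk, CharP.cast_eq_zero]
    push_cast at h
    linear_combination h
  have hder : derivative (X ^ 2 + X ^ p : L[X]) = 2 * X := by
    rw [derivative_add, derivative_X_pow, derivative_X_pow, CharP.cast_eq_zero L p, C_0, zero_mul,
      add_zero, pow_one, Nat.cast_ofNat, map_ofNat]
  rw [vectorField_apply, derivative_pow, hder]
  rcases k with - | k
  · simp_all
  · rw [Nat.add_sub_cancel, map_natCast]
    linear_combination X * (X ^ 2 + X ^ p) ^ (k + 1) * h2k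

lemma vectorField_sq_pow_half {k : ℕ} (hk : p = 2 * k + 1) (n : ℕ) :
    ((vectorField (X ^ 2 + X ^ p)) ^ (n * 2)) ((X ^ 2 + X ^ p) ^ k : L[X])
      = (-X ^ p) ^ n * (X ^ 2 + X ^ p) ^ k := by
  set W : L[X] := (X ^ 2 + X ^ p) ^ k with hW
  induction n with
  | zero => simp
  | succ n ih =>
    rw [show (n + 1) * 2 = 2 + n * 2 by ring, pow_add, Module.End.mul_apply, ih,
      pow_two (vectorField _), Module.End.mul_apply,
      vectorField_mul_of_derivative_eq_zero (derivative_neg_X_pow_char_pow n),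
      vectorField_mul_of_derivative_eq_zero (derivative_neg_X_pow_char_pow n),
      vectorField_pow_half hk, pow_succ (-X ^ p : L[X]), mul_assoc]
    have hD := vectorField_pow_half (L := L) hk
    rw [vectorField_apply, ← hW] at hD
    rw [vectorField_apply, derivative_mul, derivative_neg, derivative_X]
    linear_combination (-X ^ p) ^ n * (-X) * hD

end CharP

lemma coeff_pow_half {L : Type*} [CommRing L] (k : ℕ) :
    ((X ^ 2 + X ^ (2 * k + 1) : L[X]) ^ k).coeff (2 * k) = 1 := by
  rcases k with - | k
  · simp
  have hfactor : (X ^ 2 + X ^ (2 * (k + 1) + 1) : L[X]) ^ (k + 1)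
      = (1 + X ^ (2 * k + 1)) ^ (k + 1) * X ^ (2 * (k + 1)) := by
    rw [pow_mul X, ← mul_pow]
    ring
  have h := coeff_mul_X_pow ((1 + X ^ (2 * k + 1) : L[X]) ^ (k + 1)) (2 * (k + 1)) 0
  rw [zero_add] at h
  rw [hfactor, h, coeff_zero_eq_eval_zero]
  simp

variable {L : Type*} [NormedField L] [IsUltrametricDist L] {lam μ : L} {φ : L[X]} {τ : ℝ}

lemma CoeffLE.compOp_X_sub_C_sub_vectorField {B : ℝ} {G : L[X]} (hG : CoeffLE B G)
    (hφ : CoeffLE 1 φ) (hμ : ‖μ‖ ≤ τ) (hlam : ‖lam - 1‖ ≤ ‖μ‖ * τ) (hτ : τ ≤ 1) (N : ℕ) :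
    CoeffLE (‖μ‖ * τ * B)
      (compOp (C lam * X + μ • φ) (X - C (lam ^ N)) G - μ • vectorField φ G) := by
  have hE : ‖lam - 1‖ ≤ ‖μ‖ := hlam.trans (mul_le_of_le_one_right (norm_nonneg _) hτ)
  have hfX : C lam * X + μ • φ - X = (lam - 1) • X + μ • φ := by
    rw [smul_eq_C_mul (lam - 1), C_sub, C_1]
    ring
  have hδ : CoeffLE ‖μ‖ (C lam * X + μ • φ - X) := by
    rw [hfX]
    exact ((coeffLE_X.smul _).mono (by rwa [mul_one])).add ((hφ.smul _).mono (mul_one _).le)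
  have hf : CoeffLE 1 (C lam * X + μ • φ) :=
    sub_add_cancel (C lam * X + μ • φ) X ▸ (hδ.mono (hμ.trans hτ)).add coeffLE_X
  have htaylor := (hG.comp_sub_vectorField hf hδ).mono
    (mul_le_mul_of_nonneg_right (mul_le_mul_of_nonneg_left hμ (norm_nonneg _)) hG.nonneg)
  have hscale := ((coeffLE_X.integral_mul hG.derivative).smul (lam - 1)).mono
    (mul_le_mul_of_nonneg_right hlam hG.nonneg)
  have hpow : ‖lam ^ N - 1‖ ≤ ‖μ‖ * τ := by
    refine (norm_pow_sub_one_le ?_ N).trans hlam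
    simpa only [sub_add_cancel] using
      norm_add_le_of_norm_le (hE.trans (hμ.trans hτ)) (norm_one (α := L)).le
  have heigen := (hG.smul (lam ^ N - 1)).mono (mul_le_mul_of_nonneg_right hpow hG.nonneg)
  convert (htaylor.add hscale).sub heigen using 1
  rw [compOp_X_sub_C, hfX, vectorField_apply, vectorField_apply]
  simp only [smul_eq_C_mul, C_sub, C_1]
  ring

lemma CoeffLE.compOp_qFalling_sub_vectorField_pow {W : L[X]} (hW : CoeffLE 1 W) (hφ : CoeffLE 1 φ)
    (hμ : ‖μ‖ ≤ τ) (hlam : ‖lam - 1‖ ≤ ‖μ‖ * τ) (hτ : τ ≤ 1) (N : ℕ) :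
    CoeffLE (‖μ‖ ^ N * τ) (compOp (C lam * X + μ • φ) (qFalling lam 0 N) W
      - μ ^ N • (vectorField φ ^ N) W) := by
  have hpow : ∀ n, CoeffLE 1 ((vectorField φ ^ n) W) := fun n => by
    induction n with
    | zero => simpa using hW
    | succ n ih =>
      rw [pow_succ', Module.End.mul_apply]
      exact one_mul (1 : ℝ) ▸ coeffLE_vectorField hφ ih
  induction N with
  | zero => simpa [qFalling_zero, compOp_one] using coeffLE_zero (L := L) ((norm_nonneg μ).trans hμ)
  | succ N ih =>
    set R := compOp (C lam * X + μ • φ) (qFalling lam 0 N) W with hR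
    have hR1 : CoeffLE (‖μ‖ ^ N) R := by
      have h := (ih.mono (mul_le_of_le_one_right (by positivity) hτ)).add
        (((hpow N).smul (μ ^ N)).mono (by rw [norm_pow, mul_one]))
      rwa [sub_add_cancel] at h
    have hstep := hR1.compOp_X_sub_C_sub_vectorField hφ hμ hlam hτ N
    have herr := (coeffLE_vectorField hφ ih).smul μ
    rw [one_mul, map_sub, map_smul, smul_sub, smul_smul, ← pow_succ',
      ← Module.End.mul_apply _ (_ ^ N), ← pow_succ'] at herr
    rw [qFalling_succ, mul_comm (qFalling _ _ _), compOp_mul, ← hR, zero_add,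
      ← sub_add_sub_cancel _ (μ • vectorField φ R)]
    refine (hstep.mono (le_of_eq ?_)).add (herr.mono (le_of_eq ?_)) <;> ring

lemma not_hasPoincareSeries_balanced {p : ℕ} [Fact p.Prime] [CharP L p] (hp : p ≠ 2)
    (hlam : ‖lam - 1‖ < ‖μ‖) (hμ : ‖μ‖ < 1) : ¬ HasPoincareSeries lam (trinomial p lam μ μ) := by
  intro hP
  have hμ0 : 0 < ‖μ‖ := (norm_nonneg _).trans_lt hlam
  obtain ⟨k, hk⟩ := (Fact.out : p.Prime).odd_of_ne_two hp
  let φ : L[X] := X ^ 2 + X ^ p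
  have hφ : CoeffLE 1 φ := (coeffLE_X_pow 2).add (coeffLE_X_pow p)
  have hf : trinomial p lam μ μ = C lam * X + μ • φ := by
    rw [trinomial, smul_eq_C_mul, mul_add, add_assoc]
  set τ := max ‖μ‖ (‖lam - 1‖ / ‖μ‖)
  have hτ : τ < 1 := max_lt hμ ((div_lt_one hμ0).2 hlam)
  have hlamτ : ‖lam - 1‖ ≤ ‖μ‖ * τ := (div_le_iff₀' hμ0).1 (le_max_right _ _)
  refine hP.not_forall_pow_le (p := p) (hlam.trans hμ) two_pos (φ ^ k) (2 * k) p
    (θ := ‖μ‖ ^ 2) (by positivity) fun N => ?_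
  have hcoeff : ((vectorField φ ^ (N * 2)) (φ ^ k)).coeff (2 * k + N * p) = (-1) ^ N := by
    rw [vectorField_sq_pow_half hk, neg_pow, ← pow_mul, mul_comm p, mul_right_comm,
      coeff_mul_X_pow, ← C_1, ← C_neg, ← C_pow, coeff_C_mul, hk, coeff_pow_half, mul_one]
  have h := (hφ.pow k).compOp_qFalling_sub_vectorField_pow hφ (le_max_left _ _) hlamτ hτ.le (N * 2)
    (2 * k + N * p)
  have hnorm : ‖μ ^ (N * 2) * (-1) ^ N‖ = ‖μ‖ ^ (N * 2) := by simp
  rw [coeff_sub, coeff_smul, hcoeff, smul_eq_mul, ← hf] at h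
  rw [← pow_mul, mul_comm 2, ← hnorm, norm_eq_of_norm_sub_lt (h.trans_lt _)]
  rw [hnorm]
  exact mul_lt_of_lt_one_right (by positivity) hτ

end Balanced

section Trichotomy

variable {L : Type*} [NormedField L] {p : ℕ} {lam a b : L}

/-- The conjugation invariant `β = a (λ - 1)ᵖ⁻² / bᵖ⁻¹` of `λ X + b X² + a Xᵖ`: it is unchanged
when the variable is scaled, and its size decides where the obstruction to convergence lies. -/
noncomputable def trinomialInvariant (p : ℕ) (lam b a : L) : L :=
  a * (lam - 1) ^ (p - 2) / b ^ (p - 1)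

lemma exists_ne_zero_pow_eq [IsAlgClosed L] {x : L} (hx : x ≠ 0) {n : ℕ} (hn : 0 < n) :
    ∃ y : L, y ≠ 0 ∧ y ^ n = x := by
  obtain ⟨y, rfl⟩ := IsAlgClosed.exists_pow_nat_eq x hn
  exact ⟨y, ne_zero_pow hn.ne' hx, rfl⟩

lemma ne_zero_of_trinomialInvariant_ne_zero (h : trinomialInvariant p lam b a ≠ 0) : a ≠ 0 := by
  rintro rfl
  rw [trinomialInvariant, zero_mul, zero_div] at h
  exact h rfl

variable [IsUltrametricDist L] [IsAlgClosed L] [Fact p.Prime] [CharP L p]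

lemma not_hasPoincareSeries_of_norm_trinomialInvariant_lt (hp : 2 < p)
    (hroot : ∀ n : ℕ, 0 < n → lam ^ n ≠ 1) (hlam : ‖lam - 1‖ < 1) (hb : b ≠ 0)
    (hβ : ‖trinomialInvariant p lam b a‖ < ‖lam - 1‖) :
    ¬ HasPoincareSeries lam (trinomial p lam b a) := by
  intro hP
  have hE : lam - 1 ≠ 0 := norm_pos_iff.1 ((norm_nonneg _).trans_lt hβ)
  have hscaled := hP.trinomial_scale (by omega) (div_ne_zero hE hb)
  have hXp : a * ((lam - 1) / b) ^ (p - 1) = (lam - 1) * trinomialInvariant p lam b a := by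
    rw [trinomialInvariant, div_pow, show p - 1 = p - 2 + 1 by omega, pow_succ (lam - 1)]
    ring
  rw [mul_div_cancel₀ _ hb, hXp] at hscaled
  exact not_hasPoincareSeries_of_norm_lt hp hroot hlam hβ hscaled

lemma not_hasPoincareSeries_of_norm_trinomialInvariant_lt_one (hp : 3 < p) (hlam0 : lam ≠ 1)
    (hlam : ‖lam - 1‖ < 1) (hb : b ≠ 0) (hβE : ‖lam - 1‖ ≤ ‖trinomialInvariant p lam b a‖)
    (hβ : ‖trinomialInvariant p lam b a‖ < 1) :
    ¬ HasPoincareSeries lam (trinomial p lam b a) := by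
  intro hP
  have hE : 0 < ‖lam - 1‖ := norm_pos_iff.2 (sub_ne_zero.2 hlam0)
  have hβ0 := hE.trans_le hβE
  have ha : a ≠ 0 := ne_zero_of_trinomialInvariant_ne_zero (norm_pos_iff.1 hβ0)
  obtain ⟨ρ, hρ0, hρ⟩ := exists_ne_zero_pow_eq (div_ne_zero hb ha) (show 0 < p - 2 by omega)
  have hscaled := hP.trinomial_scale (by omega) hρ0
  have hXp : a * ρ ^ (p - 1) = b * ρ := by
    rw [show p - 1 = p - 2 + 1 by omega, pow_succ, hρ]
    field_simp
  rw [hXp] at hscaled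
  have hμ : ‖b * ρ‖ ^ (p - 2) * ‖trinomialInvariant p lam b a‖ = ‖lam - 1‖ ^ (p - 2) := by
    rw [← norm_pow, ← norm_pow, ← norm_mul, trinomialInvariant, mul_pow, hρ,
      show p - 1 = p - 2 + 1 by omega, pow_succ b]
    congr 1
    field_simp
  refine not_hasPoincareSeries_balanced (by omega) ?_ ?_ hscaled
  · refine lt_of_pow_lt_pow_left₀ (p - 2) (norm_nonneg _) (lt_of_mul_lt_mul_right ?_ hβ0.le)
    rw [hμ]
    exact mul_lt_of_lt_one_right (by positivity) hβ
  · refine (pow_lt_one_iff_of_nonneg (norm_nonneg _) (show p - 2 ≠ 0 by omega)).1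
      (lt_of_mul_lt_mul_right ?_ hβ0.le)
    rw [hμ, one_mul]
    exact (pow_lt_self_of_lt_one₀ hE hlam (by omega)).trans_le hβE

lemma not_hasPoincareSeries_of_one_le_norm_trinomialInvariant (hp : 3 < p)
    (hroot : ∀ n : ℕ, 0 < n → lam ^ n ≠ 1) (hlam : ‖lam - 1‖ < 1) (hb : b ≠ 0)
    (hβ : 1 ≤ ‖trinomialInvariant p lam b a‖) :
    ¬ HasPoincareSeries lam (trinomial p lam b a) := by
  intro hP
  have hE : lam - 1 ≠ 0 := sub_ne_zero.2 (by simpa using hroot 1 one_pos)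
  have ha : a ≠ 0 :=
    ne_zero_of_trinomialInvariant_ne_zero (norm_pos_iff.1 (one_pos.trans_le hβ))
  obtain ⟨ρ, hρ0, hρ⟩ := exists_ne_zero_pow_eq (div_ne_zero (neg_ne_zero.2 hE) ha)
    (show 0 < p - 1 by omega)
  have hscaled := hP.trinomial_scale (by omega) hρ0
  let η := b * ρ / (lam - 1)
  have hX2 : b * ρ = (lam - 1) * η := (mul_div_cancel₀ _ hE).symm
  have hXp : a * ρ ^ (p - 1) = (lam - 1) * -1 := by
    rw [hρ]
    field_simp
  rw [hX2, hXp] at hscaled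
  have hη0 : η ≠ 0 := div_ne_zero (mul_ne_zero hb hρ0) hE
  have hη : ‖η‖ ^ (p - 1) * ‖trinomialInvariant p lam b a‖ = 1 := by
    rw [← norm_pow, ← norm_mul, ← norm_one (α := L), ← norm_neg (1 : L), trinomialInvariant,
      div_pow, mul_pow, hρ, show p - 1 = p - 2 + 1 by omega, pow_succ (lam - 1)]
    congr 1
    field_simp
  have hη1 : ‖η‖ ≤ 1 := by
    refine (pow_le_one_iff_of_nonneg (norm_nonneg _) (show p - 1 ≠ 0 by omega)).1 ?_
    exact (le_mul_of_one_le_right (by positivity) hβ).trans_eq hη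
  rcases hη1.lt_or_eq with hlt | heq
  · exact not_hasPoincareSeries_resonant_of_norm_lt_one (by omega) hroot hlam hη0 hlt hscaled
  · exact not_hasPoincareSeries_resonant_of_norm_eq_one hp hroot hlam heq hscaled

theorem not_hasPoincareSeries_trinomial (hp : 3 < p) (hroot : ∀ n : ℕ, 0 < n → lam ^ n ≠ 1)
    (hlam : ‖lam - 1‖ < 1) (hb : b ≠ 0) : ¬ HasPoincareSeries lam (trinomial p lam b a) := by
  rcases lt_or_ge ‖trinomialInvariant p lam b a‖ ‖lam - 1‖ with hE | hE
  · exact not_hasPoincareSeries_of_norm_trinomialInvariant_lt (by omega) hroot hlam hb hE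
  rcases lt_or_ge ‖trinomialInvariant p lam b a‖ 1 with hβ | hβ
  · exact not_hasPoincareSeries_of_norm_trinomialInvariant_lt_one hp
      (by simpa using hroot 1 one_pos) hlam hb hE hβ
  · exact not_hasPoincareSeries_of_one_le_norm_trinomialInvariant hp hroot hlam hb hβ

end Trichotomy

section Extension

universe u

lemma exists_isAlgClosed_extension (K : Type u) [NontriviallyNormedField K] [IsUltrametricDist K] :
    ∃ (L : Type u) (_ : NormedField L) (_ : IsUltrametricDist L) (_ : IsAlgClosed L)
      (φ : K →+* L), ∀ x, ‖φ x‖ = ‖x‖ := by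
  let K' := UniformSpace.Completion K
  have hnorm : ∀ x : K, ‖(x : K')‖ = ‖x‖ := UniformSpace.Completion.norm_coe
  have : IsUltrametricDist K' := IsUltrametricDist.of_normedAlgebra K
  obtain ⟨x, hx⟩ := NormedField.exists_one_lt_norm K
  let _ : NontriviallyNormedField K' :=
    { (inferInstance : NormedField K') with non_trivial := ⟨(x : K'), by rwa [hnorm]⟩ }
  let _ : NormedField (AlgebraicClosure K') := spectralNorm.normedField K' _
  exact ⟨AlgebraicClosure K', inferInstance,
    IsUltrametricDist.isUltrametricDist_of_forall_norm_add_le_max_norm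
      (isNonarchimedean_spectralNorm (K := K') (L := AlgebraicClosure K')), inferInstance,
    (algebraMap K' _).comp UniformSpace.Completion.coeRingHom,
    fun x => (spectralNorm_extends (x : K')).trans (hnorm x)⟩

variable {K : Type*} [NontriviallyNormedField K] [IsUltrametricDist K] {p : ℕ} [Fact p.Prime]
  [CharP K p] {lam a b : K}

theorem eq_zero_of_hasPoincareSeries_trinomial (hp : 3 < p)
    (hroot : ∀ n : ℕ, 0 < n → lam ^ n ≠ 1) (hlam : ‖lam - 1‖ < 1)
    (hP : HasPoincareSeries lam (trinomial p lam b a)) : b = 0 := by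
  obtain ⟨L, _, _, _, φ, hφ⟩ := exists_isAlgClosed_extension K
  have : CharP L p := charP_of_injective_ringHom φ.injective p
  have hmap : (trinomial p lam b a).map φ = trinomial p (φ lam) (φ b) (φ a) := by
    simp [trinomial]
  by_contra hb
  refine not_hasPoincareSeries_trinomial hp (fun n hn => ?_) ?_ ((map_ne_zero φ).2 hb)
    (hmap ▸ hP.map hφ)
  · rw [← map_pow, ← map_one φ]
    exact φ.injective.ne (hroot n hn)
  · rwa [← map_one φ, ← map_sub, hφ]

theorem eq_zero_of_isLinearizable_trinomial (hp : 3 < p)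
    (hroot : ∀ n : ℕ, 0 < n → lam ^ n ≠ 1) (hlam : ‖lam - 1‖ < 1)
    (h : IsLinearizable (trinomial p lam b a : PowerSeries K)) : b = 0 := by
  have h0 : (trinomial p lam b a).coeff 0 = 0 := by
    rw [coeff_zero_eq_eval_zero]
    simp [trinomial, show p ≠ 0 by omega]
  have h1 : (trinomial p lam b a).coeff 1 = lam := by
    simp [trinomial, coeff_X_pow, show 1 ≠ p by omega]
  exact eq_zero_of_hasPoincareSeries_trinomial hp hroot hlam (h1 ▸ h.hasPoincareSeries h0)

end Extension

section Additive

variable {R : Type*} [CommRing R] {p : ℕ} [Fact p.Prime] [CharP R p]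

lemma subst_add_of_coeff_ne_zero_imp {F u v : PowerSeries R}
    (hF : ∀ n, PowerSeries.coeff n F ≠ 0 → ∃ k, n = p ^ k)
    (hu : PowerSeries.constantCoeff u = 0) (hv : PowerSeries.constantCoeff v = 0) :
    F.subst (u + v) = F.subst u + F.subst v := by
  have : CharP (PowerSeries R) p :=
    charP_of_injective_ringHom (f := PowerSeries.C (R := R)) PowerSeries.C_injective p
  ext n
  rw [map_add, coeff_subst_eq_sum (by rw [map_add, hu, hv, add_zero]), coeff_subst_eq_sum hu,
    coeff_subst_eq_sum hv, ← sum_add_distrib]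
  refine sum_congr rfl fun i _ => ?_
  by_cases hi : PowerSeries.coeff i F = 0
  · simp only [hi, zero_mul, add_zero]
  · obtain ⟨k, rfl⟩ := hF i hi
    rw [add_pow_char_pow, map_add, mul_add]

end Additive

section Frobenius

lemma isLinearizable_of_subst_eq {K : Type*} [NormedField K] {f h : PowerSeries K}
    (hf0 : PowerSeries.constantCoeff f = 0) (hh : IsLocallyAnalytic h)
    (h0 : PowerSeries.constantCoeff h = 0) (h1 : PowerSeries.coeff 1 h ≠ 0)
    (hfh : h.subst f = PowerSeries.coeff 1 f • h) : IsLinearizable f := by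
  have hb : IsUnit (PowerSeries.coeff 1 h) := h1.isUnit
  have hs := PowerSeries.HasSubst.substInvOfIsUnit h hb
  refine ⟨h, hb, hh, h0, ?_⟩
  rw [← PowerSeries.subst_comp_subst_apply (PowerSeries.HasSubst.of_constantCoeff_zero' hf0) hs,
    hfh, PowerSeries.subst_smul hs, PowerSeries.subst_substInvOfIsUnit_right _ h0,
    PowerSeries.smul_eq_C_mul]

lemma coeff_subst_C_mul_X_pow {R : Type*} [CommRing R] (F : PowerSeries R) (a : R) {p : ℕ}
    (hp : p ≠ 0) (n : ℕ) :
    PowerSeries.coeff n (F.subst (PowerSeries.C a * PowerSeries.X ^ p : PowerSeries R))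
      = if p ∣ n then a ^ (n / p) * PowerSeries.coeff (n / p) F else 0 := by
  have hX : PowerSeries.HasSubst (PowerSeries.X ^ p : PowerSeries R) :=
    PowerSeries.HasSubst.X_pow hp
  have hcomp : F.subst (PowerSeries.C a * PowerSeries.X ^ p : PowerSeries R)
      = (PowerSeries.rescale a F).subst (PowerSeries.X ^ p : PowerSeries R) := by
    rw [PowerSeries.rescale_eq_subst, PowerSeries.subst_comp_subst_apply
      (PowerSeries.HasSubst.smul_X' a) hX, PowerSeries.subst_smul hX, PowerSeries.subst_X hX,
      PowerSeries.smul_eq_C_mul]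
  rw [hcomp, PowerSeries.coeff_subst_X_pow hp, PowerSeries.coeff_rescale]
  rfl

variable {K : Type*} [NormedField K] {p : ℕ} {lam a : K}

/-- The coefficients of the linearization `h` of `f = λ X + a Xᵖ` with `h'(0) = 1`, obtained by
comparing the coefficients of `Xⁿ` in `h ∘ f = h(λ X) + h(a Xᵖ)` and `λ h`. -/
noncomputable def linearizationCoeff (p : ℕ) [hp : Fact p.Prime] (lam a : K) (n : ℕ) : K :=
  if n = 1 then 1
  else if _ : 0 < n ∧ p ∣ n then
    -(a ^ (n / p) * linearizationCoeff p lam a (n / p)) / (lam ^ n - lam)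
  else 0
termination_by n
decreasing_by exact Nat.div_lt_self ‹0 < n ∧ p ∣ n›.1 hp.out.one_lt

variable [hp : Fact p.Prime]

lemma linearizationCoeff_zero : linearizationCoeff p lam a 0 = 0 := by
  rw [linearizationCoeff, if_neg zero_ne_one, dif_neg (by simp)]

lemma linearizationCoeff_one : linearizationCoeff p lam a 1 = 1 := by
  rw [linearizationCoeff, if_pos rfl]

lemma linearizationCoeff_prime_mul {m : ℕ} (hm : 0 < m) : linearizationCoeff p lam a (p * m)
    = -(a ^ m * linearizationCoeff p lam a m) / (lam ^ (p * m) - lam) := by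
  rw [linearizationCoeff, if_neg, dif_pos ⟨mul_pos hp.out.pos hm, dvd_mul_right _ _⟩,
    Nat.mul_div_cancel_left _ hp.out.pos]
  exact fun h => hp.out.one_lt.ne' (Nat.eq_one_of_mul_eq_one_right h)

lemma linearizationCoeff_of_not_dvd {n : ℕ} (hn1 : n ≠ 1) (hn : ¬ p ∣ n) :
    linearizationCoeff p lam a n = 0 := by
  rw [linearizationCoeff, if_neg hn1, dif_neg fun h => hn h.2]

lemma exists_eq_pow_of_linearizationCoeff_ne_zero (n : ℕ)
    (hn : linearizationCoeff p lam a n ≠ 0) : ∃ k, n = p ^ k := by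
  induction n using Nat.strong_induction_on with
  | _ n ih =>
    by_cases hn1 : n = 1
    · exact ⟨0, hn1⟩
    obtain ⟨m, rfl⟩ : p ∣ n := by
      by_contra hdvd
      exact hn (linearizationCoeff_of_not_dvd hn1 hdvd)
    have hm : 0 < m := Nat.pos_of_ne_zero (by rintro rfl; exact hn linearizationCoeff_zero)
    rw [linearizationCoeff_prime_mul hm] at hn
    obtain ⟨k, rfl⟩ := ih m (lt_mul_of_one_lt_left hm hp.out.one_lt) fun h => hn (by simp [h])
    exact ⟨k + 1, (pow_succ' p k).symm⟩

lemma pow_mul_linearizationCoeff_add (hlam0 : lam ≠ 0)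
    (hroot : ∀ n : ℕ, 0 < n → lam ^ n ≠ 1) (n : ℕ) :
    lam ^ n * linearizationCoeff p lam a n
      + (if p ∣ n then a ^ (n / p) * linearizationCoeff p lam a (n / p) else 0)
      = lam * linearizationCoeff p lam a n := by
  by_cases hdvd : p ∣ n
  · obtain ⟨m, rfl⟩ := hdvd
    rcases m.eq_zero_or_pos with rfl | hm
    · simp [linearizationCoeff_zero]
    have hden : lam ^ (p * m) - lam ≠ 0 := by
      have hpm : 1 < p * m := hp.out.one_lt.trans_le (Nat.le_mul_of_pos_right p hm)
      rw [← mul_pow_sub_one (by omega : p * m ≠ 0), ← mul_sub_one]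
      exact mul_ne_zero hlam0 (sub_ne_zero.2 (hroot _ (by omega)))
    rw [if_pos (dvd_mul_right p m), Nat.mul_div_cancel_left _ hp.out.pos,
      linearizationCoeff_prime_mul hm]
    field_simp
    ring
  · rw [if_neg hdvd, add_zero]
    rcases eq_or_ne n 1 with rfl | hn1
    · rw [pow_one]
    · rw [linearizationCoeff_of_not_dvd hn1 hdvd, mul_zero, mul_zero]

variable [CharP K p]

lemma norm_linearizationCoeff_le [IsUltrametricDist K] (hlam0 : lam ≠ 1) (hlam : ‖lam - 1‖ < 1)
    (n : ℕ) : ‖linearizationCoeff p lam a n‖ ≤ (max 1 ‖a‖ / ‖lam - 1‖) ^ n := by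
  have hE : 0 < ‖lam - 1‖ := norm_pos_iff.2 (sub_ne_zero.2 hlam0)
  let r := max 1 ‖a‖ / ‖lam - 1‖
  have hr : 1 ≤ r := (one_le_div hE).2 (hlam.le.trans (le_max_left _ _))
  induction n using Nat.strong_induction_on with
  | _ n ih =>
    by_cases hdvd : p ∣ n
    · obtain ⟨m, rfl⟩ := hdvd
      rcases m.eq_zero_or_pos with rfl | hm
      · simp [linearizationCoeff_zero]
      have hpm : p * m ≠ 0 := mul_ne_zero hp.out.ne_zero hm.ne'
      have hnd : ¬ p ∣ p * m - 1 := fun h => hp.out.one_lt.ne' (Nat.dvd_one.1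
        ((Nat.dvd_sub_iff_right (Nat.one_le_iff_ne_zero.2 hpm) (dvd_mul_right p m)).1 h))
      have hden : ‖lam ^ (p * m) - lam‖ = ‖lam - 1‖ := by
        rw [← mul_pow_sub_one hpm, ← mul_sub_one, norm_mul, norm_eq_one_of_norm_sub_one_lt hlam,
          one_mul, norm_pow_sub_one_of_not_dvd hlam hnd]
      have ha : ‖a‖ ^ m / ‖lam - 1‖ ≤ r ^ m := by
        rw [div_pow]
        exact div_le_div₀ (by positivity)
          (pow_le_pow_left₀ (norm_nonneg _) (le_max_right _ _) _) (by positivity)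
          (pow_le_of_le_one hE.le hlam.le hm.ne')
      calc ‖linearizationCoeff p lam a (p * m)‖
          = ‖a‖ ^ m / ‖lam - 1‖ * ‖linearizationCoeff p lam a m‖ := by
            rw [linearizationCoeff_prime_mul hm, norm_div, norm_neg, norm_mul, norm_pow, hden]
            ring
        _ ≤ r ^ m * r ^ m := mul_le_mul ha (ih m (lt_mul_of_one_lt_left hm hp.out.one_lt))
            (norm_nonneg _) (by positivity)
        _ = r ^ (2 * m) := by rw [two_mul, pow_add]
        _ ≤ r ^ (p * m) := pow_le_pow_right₀ hr (Nat.mul_le_mul_right m hp.out.two_le)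
    · rcases eq_or_ne n 1 with rfl | hn1
      · rwa [linearizationCoeff_one, norm_one, pow_one]
      · rw [linearizationCoeff_of_not_dvd hn1 hdvd, norm_zero]
        positivity

theorem isLinearizable_C_mul_X_add_C_mul_X_pow [IsUltrametricDist K]
    (hroot : ∀ n : ℕ, 0 < n → lam ^ n ≠ 1) (hlam : ‖lam - 1‖ < 1) :
    IsLinearizable (PowerSeries.C lam * PowerSeries.X
      + PowerSeries.C a * PowerSeries.X ^ p : PowerSeries K) := by
  let h : PowerSeries K := PowerSeries.mk (linearizationCoeff p lam a)
  have hcoeff : ∀ n, PowerSeries.coeff n h = linearizationCoeff p lam a n := fun n =>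
    PowerSeries.coeff_mk n _
  have hlam0 : lam ≠ 0 := norm_ne_zero_iff.1 (by
    rw [norm_eq_one_of_norm_sub_one_lt hlam]; exact one_ne_zero)
  have hlam1 : lam ≠ 1 := by simpa using hroot 1 one_pos
  have hE : 0 < ‖lam - 1‖ := norm_pos_iff.2 (sub_ne_zero.2 hlam1)
  have hXp :
      PowerSeries.constantCoeff (PowerSeries.C a * PowerSeries.X ^ p : PowerSeries K) = 0 := by
    simp [hp.out.ne_zero]
  have hX : PowerSeries.constantCoeff (PowerSeries.C lam * PowerSeries.X : PowerSeries K) = 0 := by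
    simp
  refine isLinearizable_of_subst_eq (h := h) (by rw [map_add, hX, hXp, add_zero])
    (isLocallyAnalytic_iff.2 ⟨1, max 1 ‖a‖ / ‖lam - 1‖, by positivity, fun n => ?_⟩) ?_ ?_ ?_
  · rw [hcoeff, one_mul]
    exact norm_linearizationCoeff_le hlam1 hlam n
  · rw [← PowerSeries.coeff_zero_eq_constantCoeff_apply, hcoeff, linearizationCoeff_zero]
  · rw [hcoeff, linearizationCoeff_one]
    exact one_ne_zero
  · have hf1 : PowerSeries.coeff 1 (PowerSeries.C lam * PowerSeries.X
        + PowerSeries.C a * PowerSeries.X ^ p : PowerSeries K) = lam := by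
      simp [PowerSeries.coeff_X_pow, hp.out.one_lt.ne]
    ext n
    rw [hf1, subst_add_of_coeff_ne_zero_imp
        (fun n hn => exists_eq_pow_of_linearizationCoeff_ne_zero n (hcoeff n ▸ hn)) hX hXp,
      map_add, coeff_subst_C_mul_X_pow h a hp.out.ne_zero, ← PowerSeries.smul_eq_C_mul,
      ← PowerSeries.rescale_eq_subst, PowerSeries.coeff_rescale, map_smul, smul_eq_mul,
      hcoeff, hcoeff]
    exact pow_mul_linearizationCoeff_add hlam0 hroot n

end Frobenius

end NonArchLinearization

theorem theorem1p5_general {K : Type*} [NormedField K] [IsUltrametricDist K]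
    (p : ℕ) [Fact p.Prime] [CharP K p] (hp : 5 ≤ p)
    (lam : K) (hroot : ∀ n : ℕ, 0 < n → lam ^ n ≠ 1) (hlam : ‖1 - lam‖ < 1)
    (a₁ a : K) :
    NonArchLinearization.IsLinearizable
      (PowerSeries.C lam * PowerSeries.X + PowerSeries.C a₁ * PowerSeries.X ^ 2 +
        PowerSeries.C a * PowerSeries.X ^ p) ↔ a₁ = 0 := by
  rw [norm_sub_rev] at hlam
  constructor
  · intro h
    let _ : NontriviallyNormedField K := NontriviallyNormedField.ofNormNeOne
      ⟨lam - 1, sub_ne_zero.2 (by simpa using hroot 1 one_pos), hlam.ne⟩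
    refine NonArchLinearization.eq_zero_of_isLinearizable_trinomial (p := p) (lam := lam) (a := a)
      (by omega) hroot hlam ?_
    simpa [NonArchLinearization.trinomial] using h
  · rintro rfl
    simpa using NonArchLinearization.isLinearizable_C_mul_X_add_C_mul_X_pow hroot hlam

theorem theorem1p5 {K : Type*} [NormedField K] [IsUltrametricDist K] [CompleteSpace K]
    (p : ℕ) [Fact p.Prime] [CharP K p] (hp : 5 ≤ p)
    (lam : K) (hroot : ∀ n : ℕ, 0 < n → lam ^ n ≠ 1) (hlam : ‖1 - lam‖ < 1)
    (a₁ a : K) :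
    NonArchLinearization.IsLinearizable
      (PowerSeries.C lam * PowerSeries.X + PowerSeries.C a₁ * PowerSeries.X ^ 2 +
        PowerSeries.C a * PowerSeries.X ^ p) ↔ a₁ = 0 :=
  theorem1p5_general p hp lam hroot hlam a₁ a
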